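/- For a permutation $\pi=\pi_1\cdots\pi_n\in S_n$ and a pattern $\sigma=\sigma_1\cdots\sigma_k\in S_k$ (one-line notation), say that $\pi$ contains $\sigma$ if there are indices $i_1<\cdots<i_k$ such that $\pi_{i_1}\cdots\pi_{i_k}$ is order isomorphic to $\sigma_1\cdots\sigma_k$, and that $\pi$ avoids $\sigma$ otherwise. Let $e_n(\sigma)$ be the number of even permutations $\pi\in S_n$ that avoid $\sigma$. Two patterns $\sigma,\tau$ are even-Wilf-equivalent, written $\sigma\approx\tau$, if $e_n(\sigma)=e_n(\tau)$ for all $n\ge 0$. (a) In $S_5$ the following equivalences hold: $12345\approx 23451$, $45312\approx 34512$, $15432\approx 54321$, $21354\approx 21543$, $12354\approx 12543$, $45321\approx 34521$. (b) In $S_6$, within each of the following ten sets any two patterns are even-Wilf-equivalent: 1. $\{123465, 123654, 213456, 321456\}$ 2. $\{126543, 165432, 432156, 543216\}$ 3. $\{132465, 132654, 213546, 321546\}$ 4. $\{213465, 213654, 321465, 321654\}$ 5. $\{213564, 213645, 231465, 231654, 312465, 312654, 321564, 321645\}$ 6. $\{234561, 345621, 612345, 651234\}$ 7. $\{456123, 456312,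 564123, 564312\}$ 8. $\{456132, 456213, 465123, 465312, 546123, 546312, 564132, 564213\}$ 9. $\{456231, 564231, 645123, 645312\}$ 10. $\{456321, 564321, 654123, 654312\}$ -/

import Mathlib

namespace EvenWilf

/-- `π` contains the pattern `σ`: there are positions `f 0 < f 1 < ⋯ < f (k-1)` at which the
entries of `π` are order isomorphic to `σ`. -/
def Contains {n k : ℕ} (π : Equiv.Perm (Fin n)) (σ : Equiv.Perm (Fin k)) : Prop :=
  ∃ f : Fin k → Fin n, StrictMono f ∧ ∀ i j : Fin k, π (f i) < π (f j) ↔ σ i < σ j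

/-- The set of even permutations of length `n` that avoid the pattern `σ`. -/
def evenAvoiders (n : ℕ) {k : ℕ} (σ : Equiv.Perm (Fin k)) : Set (Equiv.Perm (Fin n)) :=
  {π | Equiv.Perm.sign π = 1 ∧ ¬ Contains π σ}

/-- Even-Wilf-equivalence: for every `n`, as many even permutations of length `n` avoid `σ`
as avoid `τ`. -/
def EvenWilfEquiv {k l : ℕ} (σ : Equiv.Perm (Fin k)) (τ : Equiv.Perm (Fin l)) : Prop :=
  ∀ n : ℕ, (evenAvoiders n σ).ncard = (evenAvoiders n τ).ncard

/-- `w` is the one-line notation, with letters `1, …, k`, of the permutation `σ`. -/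
def IsOneLine {k : ℕ} (w : Fin k → ℕ) (σ : Equiv.Perm (Fin k)) : Prop :=
  ∀ i : Fin k, w i = (σ i : ℕ) + 1

/-- The words `u` and `v` are the one-line notations of permutations, and these (uniquely
determined) permutations are even-Wilf-equivalent. -/
def WordsEquiv {k l : ℕ} (u : Fin k → ℕ) (v : Fin l → ℕ) : Prop :=
  ∃ (σ : Equiv.Perm (Fin k)) (τ : Equiv.Perm (Fin l)),
    IsOneLine u σ ∧ IsOneLine v τ ∧ EvenWilfEquiv σ τ

end EvenWilf

/-! All equivalences come from one family: for odd `t = S + 2` and any pattern `σ`, the direct sums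
of `t ⋯ 1` and of `(t - 1) ⋯ 1 t` with `σ` are avoided by equally many permutations of each length
and sign (`signedWilfEquiv_directSum`). The cases `t = 3` and `t = 5`, combined with reversal,
inversion and reverse-complement, give both parts.

The cells to the left of and below some occurrence of `σ` in `p` form a board closed under going
left and down. The permutation `p` contains the direct sum of `ρ` and `σ` exactly when an occurrence
of `ρ` has its corner cell (last position, largest value) in that board. Changing entries only
inside the board leaves the board as it is, so one may fix the board and the sign and compare the
two patterns inside the board (`ncard_board_avoiders_eq`).

There a threshold `m` sweeps over the values: one counts the `p` without a `t ⋯ 1` whose largest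
value is below `m` and without a `(t - 1) ⋯ 1 t` whose largest value is at least `m`. Raising the
threshold past `r` keeps the count because of a bijection (`ncard_hasDesc_eq`). It takes the lowest
decreasing subsequence with top `r`, moves its other entries one place to the left within the
subsequence, and puts `r` at its right end. This slide multiplies `p` by a `t`-cycle, which is even
for odd `t`. Its inverse is the analogous greedy choice of highest entries. What remains is that a
slide creates no forbidden occurrence with top other than `r`, in either direction; this is an
exchange argument on crossing decreasing subsequences. -/

namespace EvenWilf

/-! ### Chains of a relation and greedy chains. -/

/-- There is an `R`-chain with `k` steps that starts at `x` and all of whose members satisfy `P`. -/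
def ChainFrom {α : Type*} (R : α → α → Prop) (P : α → Prop) : ℕ → α → Prop
  | 0, x => P x
  | k + 1, x => P x ∧ ∃ y, R x y ∧ ChainFrom R P k y

section Chains

variable {α : Type*} {R : α → α → Prop} {P Q : α → Prop}

theorem ChainFrom.head {k : ℕ} {x : α} (h : ChainFrom R P k x) : P x := by
  cases k with
  | zero => exact h
  | succ k => exact h.1

theorem ChainFrom.cons {k : ℕ} {x y : α} (hx : P x) (hxy : R x y) (h : ChainFrom R P k y) :
    ChainFrom R P (k + 1) x := ⟨hx, y, hxy, h⟩

theorem ChainFrom.of_succ {k : ℕ} {x : α} (h : ChainFrom R P (k + 1) x) : ChainFrom R P k x := by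
  induction k generalizing x with
  | zero => exact h.head
  | succ k ih =>
    obtain ⟨hx, y, hxy, hy⟩ := h
    exact ⟨hx, y, hxy, ih hy⟩

theorem ChainFrom.anti {k l : ℕ} {x : α} (h : ChainFrom R P k x) (hlk : l ≤ k) :
    ChainFrom R P l x := by
  induction k, hlk using Nat.le_induction with
  | base => exact h
  | succ k _ ih => exact ih h.of_succ

theorem ChainFrom.mono {k : ℕ} {x : α} (h : ChainFrom R P k x) (hPQ : ∀ z, P z → Q z) :
    ChainFrom R Q k x := by
  induction k generalizing x with
  | zero => exact hPQ _ h
  | succ k ih =>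
    obtain ⟨hx, y, hxy, hy⟩ := h
    exact ⟨hPQ _ hx, y, hxy, ih hy⟩

/-- A chain ending at `y` and a chain starting at `y` join. -/
theorem ChainFrom.join {k m : ℕ} {y : α} (hP : ∀ x z, R x z → P z → P x)
    (h₁ : ChainFrom (fun a b => R b a) Q k y) (h₂ : ChainFrom R P m y) :
    ∃ x, Q x ∧ ChainFrom R P (k + m) x := by
  induction k generalizing y m with
  | zero => exact ⟨y, h₁, by simpa using h₂⟩
  | succ k ih =>
    obtain ⟨-, x, hxy, hx⟩ := h₁
    obtain ⟨z, hz, hc⟩ := ih hx (h₂.cons (hP _ _ hxy h₂.head) hxy)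
    exact ⟨z, hz, by rwa [Nat.add_right_comm, Nat.add_assoc]⟩

/-- A chain that always continues with the least possible value. -/
theorem ChainFrom.exists_greedy [Finite α] {β : Type*} [LinearOrder β] (f : α → β) {k : ℕ} {x : α}
    (h : ChainFrom R P k x) :
    ∃ c : ℕ → α, c k = x ∧ (∀ i ≤ k, ChainFrom R P i (c i)) ∧ ∀ i < k, R (c (i + 1)) (c i) ∧
      ∀ y, R (c (i + 1)) y → f y < f (c i) → ¬ ChainFrom R P i y := by
  induction k generalizing x with
  | zero =>
    refine ⟨fun _ => x, rfl, ?_, by simp⟩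
    intro i hi
    obtain rfl : i = 0 := by omega
    exact h
  | succ k ih =>
    obtain ⟨y, ⟨hxy, hy⟩, hmin⟩ := Set.exists_min_image {y | R x y ∧ ChainFrom R P k y} f
      (Set.toFinite _) h.2
    obtain ⟨c, hck, hc, hcR⟩ := ih hy
    refine ⟨fun i => if i ≤ k then c i else x, by simp, ?_, ?_⟩
    · intro i hi
      by_cases hik : i ≤ k
      · simpa [hik] using hc i hik
      · obtain rfl : i = k + 1 := by omega
        simpa using h
    · intro i hi
      rcases Nat.lt_succ_iff_lt_or_eq.mp hi with hi | rfl
      · have h1 : i ≤ k := by omega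
        have h2 : i + 1 ≤ k := hi
        simpa [h1, h2] using hcR i hi
      · have h2 : ¬ (i + 1 ≤ i) := by omega
        simp only [le_refl, if_true, h2, if_false, hck]
        refine ⟨hxy, fun z hz hlt hz' => ?_⟩
        exact absurd (hmin z ⟨hz, hz'⟩) (not_le.mpr hlt)

end Chains

/-! ### Decreasing subsequences and the cycle behind a slide. -/

/-- Positions `x < y` carry a descent of `p`. -/
def Desc {n : ℕ} (p : Equiv.Perm (Fin n)) (x y : Fin n) : Prop := x < y ∧ p y < p x

/-- A decreasing subsequence of `p` with `k + 1` entries that starts at position `x`, all of whose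
positions satisfy `P`. -/
abbrev DescFrom {n : ℕ} (p : Equiv.Perm (Fin n)) (P : Fin n → Prop) : ℕ → Fin n → Prop :=
  ChainFrom (Desc p) P

/-- A decreasing subsequence of `p` with `k + 1` entries that ends at position `x`, all of whose
values satisfy `B`. -/
abbrev DescTo {n : ℕ} (p : Equiv.Perm (Fin n)) (B : Fin n → Prop) : ℕ → Fin n → Prop :=
  ChainFrom (fun y x => Desc p x y) (fun x => B (p x))

/-- The permutation moving each `c (i + 1)` to `c i` and `c 0` to `c k`. -/
theorem exists_cycle {α : Type*} [Fintype α] [DecidableEq α] (c : ℕ → α) (k : ℕ)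
    (hc : ∀ i j, i < j → j ≤ k → c i ≠ c j) :
    ∃ g : Equiv.Perm α, (∀ i < k, g (c (i + 1)) = c i) ∧ g (c 0) = c k ∧
      (∀ x, (∀ i ≤ k, x ≠ c i) → g x = x) ∧ Equiv.Perm.sign g = (-1) ^ k := by
  induction k with
  | zero => exact ⟨1, by simp, rfl, by simp, by simp⟩
  | succ k ih =>
    obtain ⟨g, h1, h2, h3, h4⟩ := ih fun i j hij hj => hc i j hij (by omega)
    refine ⟨Equiv.swap (c k) (c (k + 1)) * g, ?_, ?_, ?_, ?_⟩
    · intro i hi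
      rcases Nat.lt_succ_iff_lt_or_eq.mp hi with hi | rfl
      · rw [Equiv.Perm.mul_apply, h1 i hi, Equiv.swap_apply_of_ne_of_ne]
        · exact hc _ _ hi (by omega)
        · exact hc _ _ (by omega) le_rfl
      · rw [Equiv.Perm.mul_apply, h3, Equiv.swap_apply_right]
        exact fun j hj => (hc j _ (by omega) le_rfl).symm
    · rw [Equiv.Perm.mul_apply, h2, Equiv.swap_apply_left]
    · intro x hx
      rw [Equiv.Perm.mul_apply, h3 x fun i hi => hx i (by omega),
        Equiv.swap_apply_of_ne_of_ne (hx _ (by omega)) (hx _ le_rfl)]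
    · rw [Equiv.Perm.sign_mul, Equiv.Perm.sign_swap (hc _ _ (by omega) le_rfl), h4, pow_succ']

/-! ### Slides and their effect on decreasing subsequences. -/

section Slides

variable {n : ℕ}

/-- `p'` arises from `p` by moving the entries of the decreasing subsequence at the positions
`c (S + 1) < ⋯ < c 0` one step to the left, and the largest of them, `r`, to the right end. -/
structure Slide (p p' g : Equiv.Perm (Fin n)) (c : ℕ → Fin n) (S : ℕ) (r : Fin n)
    (W : Fin n → Prop) : Prop where
  pos : ∀ i j, i < j → j ≤ S + 1 → c j < c i
  val : ∀ i j, i < j → j ≤ S + 1 → p (c i) < p (c j)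
  top : p (c (S + 1)) = r
  shift : ∀ i ≤ S, g (c (i + 1)) = c i
  shift_zero : g (c 0) = c (S + 1)
  fixed : ∀ x, (∀ i ≤ S + 1, x ≠ c i) → g x = x
  apply : ∀ x, p' x = p (g x)
  corner : W (c 0)
  down : ∀ x y, x < y → W y → W x

/-- To the right of `c (q + 1)` and below the value at `c q` no decreasing subsequence with
`q + 1` entries starts. -/
def LowCond (p : Equiv.Perm (Fin n)) (c : ℕ → Fin n) (S : ℕ) (W : Fin n → Prop) : Prop :=
  ∀ q ≤ S + 1, ∀ y, (q ≤ S → c (q + 1) < y) → p y < p (c q) → ¬ DescFrom p W q y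

/-- To the left of `c q` and above the value at `c (q + 1)` no decreasing subsequence with
`S - q + 1` entries, all less than `r`, ends. -/
def UpCond (p' : Equiv.Perm (Fin n)) (c : ℕ → Fin n) (S : ℕ) (r : Fin n) : Prop :=
  ∀ q ≤ S, ∀ y, y < c q → p' (c (q + 1)) < p' y → p' y < r → ¬ DescTo p' (· < r) (S - q) y

variable {p p' g : Equiv.Perm (Fin n)} {c : ℕ → Fin n} {S : ℕ} {r : Fin n} {W : Fin n → Prop}

namespace Slide

theorem pos_le (h : Slide p p' g c S r W) {i j : ℕ} (hij : i ≤ j) (hj : j ≤ S + 1) :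
    c j ≤ c i := by
  rcases hij.eq_or_lt with rfl | hij
  · exact le_rfl
  · exact (h.pos i j hij hj).le

theorem val_le (h : Slide p p' g c S r W) {i j : ℕ} (hij : i ≤ j) (hj : j ≤ S + 1) :
    p (c i) ≤ p (c j) := by
  rcases hij.eq_or_lt with rfl | hij
  · exact le_rfl
  · exact (h.val i j hij hj).le

theorem val_top (h : Slide p p' g c S r W) {i : ℕ} (hi : i ≤ S) : p (c i) < r :=
  h.top ▸ h.val i (S + 1) (by omega) le_rfl

theorem lt_of_pos (h : Slide p p' g c S r W) {i j : ℕ} (hi : i ≤ S + 1) (hij : c j < c i) :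
    i < j := by
  by_contra hji
  exact absurd (h.pos_le (not_lt.mp hji) hi) (not_le.mpr hij)

theorem lt_of_val (h : Slide p p' g c S r W) {i j : ℕ} (hi : i ≤ S + 1)
    (hij : p (c i) < p (c j)) : i < j := by
  by_contra hji
  exact absurd (h.val_le (not_lt.mp hji) hi) (not_le.mpr hij)

theorem apply_succ (h : Slide p p' g c S r W) {i : ℕ} (hi : i ≤ S) :
    p' (c (i + 1)) = p (c i) := by rw [h.apply, h.shift i hi]

theorem apply_zero (h : Slide p p' g c S r W) : p' (c 0) = r := by
  rw [h.apply, h.shift_zero, h.top]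

theorem apply_off (h : Slide p p' g c S r W) {x : Fin n} (hx : ∀ i ≤ S + 1, x ≠ c i) :
    p' x = p x := by rw [h.apply, h.fixed x hx]

theorem val_succ (h : Slide p p' g c S r W) {i j : ℕ} (hij : i < j) (hj : j ≤ S) :
    p' (c (i + 1)) < p' (c (j + 1)) := by
  rw [h.apply_succ hj, h.apply_succ (by omega)]
  exact h.val i j hij (by omega)

theorem cases (_ : Slide p p' g c S r W) (x : Fin n) :
    x = c 0 ∨ (∃ i ≤ S, x = c (i + 1)) ∨ ∀ i ≤ S + 1, x ≠ c i := by
  by_cases hx : ∀ i ≤ S + 1, x ≠ c i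
  · exact Or.inr (Or.inr hx)
  · push Not at hx
    obtain ⟨i, hi, rfl⟩ := hx
    cases i with
    | zero => exact Or.inl rfl
    | succ i => exact Or.inr (Or.inl ⟨i, by omega, rfl⟩)

theorem ne_zero (h : Slide p p' g c S r W) {x : Fin n} (hx : p' x ≠ r) : x ≠ c 0 := by
  rintro rfl
  exact hx h.apply_zero

theorem le_apply (h : Slide p p' g c S r W) {x : Fin n} (hx : x ≠ c 0) : x ≤ g x := by
  rcases h.cases x with h0 | ⟨i, hi, rfl⟩ | hx
  · exact absurd h0 hx
  · rw [h.shift i hi]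
    exact h.pos_le (by omega) (by omega)
  · rw [h.fixed x hx]

theorem val_apply_le (h : Slide p p' g c S r W) {x : Fin n} (hx : x ≠ c 0) : p' x ≤ p x := by
  rcases h.cases x with h0 | ⟨i, hi, rfl⟩ | hx
  · exact absurd h0 hx
  · rw [h.apply_succ hi]
    exact h.val_le (by omega) (by omega)
  · rw [h.apply_off hx]

/-- The entries of the slide are a decreasing subsequence of `p`. -/
theorem descFrom (h : Slide p p' g c S r W) {i : ℕ} (hi : i ≤ S + 1) : DescFrom p W i (c i) := by
  induction i with
  | zero => exact h.corner
  | succ i ih =>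
    exact (ih (by omega)).cons (h.down _ _ (h.pos 0 (i + 1) (by omega) hi) h.corner)
      ⟨h.pos _ _ (by omega) hi, h.val _ _ (by omega) hi⟩

theorem descFrom_add (h : Slide p p' g c S r W) {P : Fin n → Prop}
    (hP : ∀ x y, x < y → P y → P x) {i j k : ℕ} (hij : i ≤ j) (hj : j ≤ S + 1)
    (hk : DescFrom p P k (c i)) : DescFrom p P (k + (j - i)) (c j) := by
  induction j, hij using Nat.le_induction with
  | base => simpa using hk
  | succ j hij ih =>
    have h1 := ih (by omega)
    have h2 : k + (j + 1 - i) = k + (j - i) + 1 := by omega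
    have h3 := h.pos j (j + 1) (by omega) hj
    rw [h2]
    exact h1.cons (hP _ _ h3 h1.head) ⟨h3, h.val _ _ (by omega) hj⟩

theorem descTo_add (h : Slide p p' g c S r W) {B : Fin n → Prop}
    (hB : ∀ x y, x < y → B y → B x) {i j k : ℕ} (hij : i ≤ j) (hj : j ≤ S + 1)
    (hk : DescTo p B k (c j)) : DescTo p B (k + (j - i)) (c i) := by
  induction hd : j - i generalizing i with
  | zero =>
    obtain rfl : i = j := by omega
    simpa using hk
  | succ d ih =>
    have h1 := ih (i := i + 1) (by omega) (by omega)
    have h3 := h.val i (i + 1) (by omega) (by omega)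
    exact h1.cons (hB _ _ h3 h1.head) ⟨h.pos _ _ (by omega) (by omega), h3⟩

theorem descFrom_add' (h : Slide p p' g c S r W) {P : Fin n → Prop}
    (hP : ∀ x y, x < y → P y → P x) {i j k : ℕ} (hij : i ≤ j) (hj : j ≤ S)
    (hk : DescFrom p' P k (c (i + 1))) : DescFrom p' P (k + (j - i)) (c (j + 1)) := by
  induction j, hij using Nat.le_induction with
  | base => simpa using hk
  | succ j hij ih =>
    have h1 := ih (by omega)
    have h2 : k + (j + 1 - i) = k + (j - i) + 1 := by omega
    have h3 := h.pos (j + 1) (j + 1 + 1) (by omega) (by omega)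
    rw [h2]
    exact h1.cons (hP _ _ h3 h1.head) ⟨h3, h.val_succ (by omega) hj⟩

theorem descTo_add' (h : Slide p p' g c S r W) {B : Fin n → Prop}
    (hB : ∀ x y, x < y → B y → B x) {i j k : ℕ} (hij : i ≤ j) (hj : j ≤ S)
    (hk : DescTo p' B k (c (j + 1))) : DescTo p' B (k + (j - i)) (c (i + 1)) := by
  induction hd : j - i generalizing i with
  | zero =>
    obtain rfl : i = j := by omega
    simpa using hk
  | succ d ih =>
    have h1 := ih (i := i + 1) (by omega) (by omega)
    have h3 := h.val_succ (i := i) (j := i + 1) (by omega) (by omega)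
    exact h1.cons (hB _ _ h3 h1.head) ⟨h.pos _ _ (by omega) (by omega), h3⟩

/-- The moved entries are a decreasing subsequence of `p'` below `r`. -/
theorem descTo' (h : Slide p p' g c S r W) {i : ℕ} (hi : i ≤ S) :
    DescTo p' (· < r) (S - i) (c (i + 1)) := by
  have h0 : DescTo p' (· < r) 0 (c (S + 1)) := by
    change p' (c (S + 1)) < r
    rw [h.apply_succ le_rfl]
    exact h.val_top le_rfl
  simpa using h.descTo_add' (fun x y hxy hy => hxy.trans hy) hi le_rfl h0

/-- The entry at `x` lies to the left of and below the staircase formed by the slide. Taking the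
least `v` whose entry exceeds it makes `x, c (v - 1), …, c 0` decreasing. -/
theorem row_slot (h : Slide p p' g c S r W) {x : Fin n} {j : ℕ} (hj : j ≤ S + 1) (hx : x < c j)
    (hv : p x < p (c j)) :
    ∃ v ≤ j, x < c v ∧ p x < p (c v) ∧ ∀ i < v, p (c i) ≤ p x := by
  classical
  have hex : ∃ v, p x < p (c v) := ⟨j, hv⟩
  have hle : Nat.find hex ≤ j := Nat.find_min' hex hv
  exact ⟨Nat.find hex, hle, hx.trans_le (h.pos_le hle hj), Nat.find_spec hex,
    fun i hi => not_lt.mp (Nat.find_min hex hi)⟩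

/-- The greatest index `w` with `x < c w` puts `x` in the column between `c (w + 1)` and `c w`,
which is where `LowCond` at `w` speaks about `x`. -/
theorem col_slot (_ : Slide p p' g c S r W) {x : Fin n} {j : ℕ} (hj : j ≤ S + 1) (hx : x < c j) :
    ∃ w ≤ S + 1, j ≤ w ∧ x < c w ∧ (w ≤ S → c (w + 1) ≤ x) := by
  obtain ⟨w, hw, hmax⟩ := Finset.exists_max_image
    ((Finset.range (S + 2)).filter fun i => x < c i) id
    ⟨j, by simp only [Finset.mem_filter, Finset.mem_range]; exact ⟨by omega, hx⟩⟩
  simp only [Finset.mem_filter, Finset.mem_range, id_eq] at hw hmax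
  refine ⟨w, by omega, hmax j ⟨by omega, hx⟩, hw.2, fun hwS => not_lt.mp fun hlt => ?_⟩
  have := hmax (w + 1) ⟨by omega, hlt⟩
  omega

theorem of_val (h : Slide p p' g c S r W) {B : Fin n → Prop} (hB : ∀ x y, x < y → B y → B x)
    (hBr : B r) {i : ℕ} (hi : i ≤ S + 1) : B (p (c i)) := by
  rcases (h.val_le hi le_rfl).eq_or_lt with he | hlt
  · rwa [he, h.top]
  · exact hB _ _ hlt (by rwa [h.top])

theorem of_pos (h : Slide p p' g c S r W) {P : Fin n → Prop} (hP : ∀ x y, x < y → P y → P x)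
    (hP0 : P (c 0)) {i : ℕ} (hi : i ≤ S + 1) : P (c i) := by
  rcases (h.pos_le (Nat.zero_le i) hi).eq_or_lt with he | hlt
  · rwa [he]
  · exact hP _ _ hlt hP0

/-- Two crossing decreasing subsequences, the given one from `y` and the slide from `c v`, swap
tails where the former leaves the region under the staircase. The total number of steps is
preserved, so a bound on `m` forces `l` to be large. -/
theorem low_row_exchange (h : Slide p p' g c S r W) {P : Fin n → Prop}
    (hP : ∀ x y, x < y → P y → P x) (hP0 : P (c 0)) {k v : ℕ} {y : Fin n} (hv : v ≤ S + 1)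
    (hyc : y < c v) (hyv : p y < p (c v)) (hlow : ∀ i < v, p (c i) ≤ p y)
    (hy : DescFrom p P k y) :
    ∃ m l, DescFrom p W m y ∧ DescFrom p P l (c v) ∧ l + m = k + v := by
  have hchain : ∀ {y : Fin n} {v : ℕ}, v ≤ S + 1 → y < c v → (∀ i < v, p (c i) ≤ p y) →
      DescFrom p W v y := by
    intro y v hv hyc hlow
    have hWy : W y := h.down _ _ (hyc.trans_le (h.pos_le (Nat.zero_le _) hv)) h.corner
    cases v with
    | zero => exact hWy
    | succ v =>
      have hlt := hyc.trans (h.pos v (v + 1) (by omega) hv)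
      refine (h.descFrom (i := v) (by omega)).cons hWy ⟨hlt, lt_of_le_of_ne (hlow v (by omega)) ?_⟩
      exact fun he => hlt.ne' (p.injective he)
  induction k generalizing y v with
  | zero => exact ⟨v, 0, hchain hv hyc hlow, h.of_pos hP hP0 hv, rfl⟩
  | succ k ih =>
    obtain ⟨-, z, ⟨hyz, hzy⟩, hz⟩ := hy
    by_cases hzV : ∃ j ≤ S + 1, z < c j ∧ p z < p (c j)
    · obtain ⟨j, hj, hzc, hzv⟩ := hzV
      obtain ⟨w, hwj, hzc, hzv, hzlow⟩ := h.row_slot hj hzc hzv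
      have hwv : w ≤ v := by
        by_contra hlt
        exact absurd (hzy.trans hyv) (not_lt.mpr (hzlow v (by omega)))
      obtain ⟨m, l, hm, hl, hml⟩ := ih (hwv.trans hv) hzc hzv hzlow hz
      refine ⟨m + 1, l + (v - w), hm.cons (h.down _ _ hyz hm.head) ⟨hyz, hzy⟩,
        h.descFrom_add hP hwv hv hl, by omega⟩
    · push Not at hzV
      have h1 : p z < p (c v) := hzy.trans hyv
      have h2 : c v < z := by
        refine lt_of_le_of_ne (not_lt.mp fun hlt => ?_) ?_
        · exact absurd h1 (not_lt.mpr (hzV v hv hlt))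
        · rintro rfl
          exact lt_irrefl _ h1
      exact ⟨v, k + 1, hchain hv hyc hlow, hz.cons (h.of_pos hP hP0 hv) ⟨h2, h1⟩, by omega⟩

/-- Going back from `p'` to `p` does not shorten decreasing subsequences with given first value. -/
theorem descFrom_step (h : Slide p p' g c S r W) (hlow : LowCond p c S W) {P : Fin n → Prop}
    (hP : ∀ x y, x < y → P y → P x) (hP0 : P (c 0)) {k : ℕ} {x y : Fin n}
    (hxy : Desc p' x y) (hxr : p' x < r) (hy : DescFrom p P k (g y)) :
    DescFrom p P (k + 1) (g x) := by
  obtain ⟨hlt, hval⟩ := hxy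
  have hy0 := h.ne_zero (hval.trans hxr).ne
  have hyg := h.le_apply hy0
  have hval' : p (g y) < p (g x) := by rwa [← h.apply, ← h.apply]
  suffices hs : g x < g y ∨ DescFrom p P (k + 1) (g x) by
    rcases hs with hs | hs
    · exact hy.cons (hP _ _ hs hy.head) ⟨hs, hval'⟩
    · exact hs
  rcases h.cases x with h0 | ⟨i, hi, rfl⟩ | hx
  · exact absurd h0 (h.ne_zero hxr.ne)
  · rcases h.cases y with h0 | ⟨j, hj, rfl⟩ | hy'
    · exact absurd h0 hy0
    · left
      rw [h.shift i hi, h.shift j hj]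
      exact h.pos _ _ (by have := h.lt_of_pos (by omega) hlt; omega) (by omega)
    · rw [h.fixed y hy'] at hy hval' ⊢
      rw [h.shift i hi] at hval' ⊢
      rcases lt_or_gt_of_ne (hy' i (by omega)) with hyi | hyi
      · right
        -- The critical case: undoing the slide moves the entry at `c (i + 1)` to `c i`, to the
        -- right of `y`, and the descent is lost. `LowCond` allows `y` fewer than `i` steps within
        -- `W`, so the exchange gives `c v`, and through it `c i`, at least `k + 1` steps.
        obtain ⟨v, hvi, hyc, hyv, hl⟩ := h.row_slot (by omega) hyi hval'
        obtain ⟨m, l, hm, hl, hml⟩ := h.low_row_exchange hP hP0 (by omega) hyc hyv hl hy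
        have hmi : m < i := by
          by_contra hge
          exact hlow i (by omega) y (fun _ => hlt) hval' (hm.anti (not_lt.mp hge))
        exact (h.descFrom_add hP hvi (by omega) hl).anti (by omega)
      · exact Or.inl hyi
  · left
    rw [h.fixed x hx]
    exact hlt.trans_le hyg

/-- The exchange for heads in place of tails. Going back along the chain that ends at `y`, either
the predecessor lies above `c q` and can precede it, or it is again under the staircase in a column
further left. In the latter case the tail length `m` grows by one, which pays for the larger index.
-/
theorem low_col_exchange (h : Slide p p' g c S r W) (hlow : LowCond p c S W) {B : Fin n → Prop}
    (hB : ∀ x y, x < y → B y → B x) (hBr : B r) {k q m : ℕ} {y : Fin n} (hq : q ≤ S + 1)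
    (hyc : y < c q) (hcy : q ≤ S → c (q + 1) < y) (hyv : p y < p (c q))
    (hy : DescTo p B k y) (hm : DescFrom p W m y) {l : ℕ} (hl : l + q ≤ k + m + 1) :
    DescTo p B l (c q) := by
  induction k generalizing y q m l with
  | zero =>
    have hmq : m < q := by
      by_contra hge
      exact hlow q hq y hcy hyv (hm.anti (not_lt.mp hge))
    obtain rfl : l = 0 := by omega
    exact h.of_val hB hBr hq
  | succ k ih =>
    have hmq : m < q := by
      by_contra hge
      exact hlow q hq y hcy hyv (hm.anti (not_lt.mp hge))
    obtain ⟨-, x, ⟨hxy, hyx⟩, hx⟩ := hy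
    by_cases hxV : ∃ j ≤ S + 1, x < c j ∧ p x < p (c j)
    · obtain ⟨j, hj, hxc, hxv⟩ := hxV
      obtain ⟨w, hw, hjw, hxw, hcw⟩ := h.col_slot hj hxc
      have hqw : q ≤ w := by
        by_contra hlt
        have h1 := hcw (by omega)
        have h2 := h.pos_le (i := w + 1) (j := q) (by omega) hq
        exact absurd (hxy.trans hyc) (not_lt.mpr (h2.trans h1))
      have hcx : w ≤ S → c (w + 1) < x := fun hwS => by
        refine lt_of_le_of_ne (hcw hwS) ?_
        rintro rfl
        have := h.lt_of_val (i := w + 1) (by omega) hxv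
        omega
      have hxv' : p x < p (c w) := hxv.trans_le (h.val_le hjw hw)
      have hm' := hm.cons (h.down _ _ hxy hm.head) ⟨hxy, hyx⟩
      by_cases hlq : w - q ≤ l
      · have h1 := ih hw hxw hcx hxv' hx hm' (l := l - (w - q)) (by omega)
        exact (h.descTo_add hB hqw hw h1).anti (by omega)
      · exact (h.descTo_add hB (k := 0) hqw hw (h.of_val hB hBr hw)).anti (by omega)
    · push Not at hxV
      have h1 : x < c q := hxy.trans hyc
      have h2 : p (c q) < p x :=
        lt_of_le_of_ne (hxV q hq h1) fun he => h1.ne' (p.injective he)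
      exact (hx.cons (h.of_val hB hBr hq) ⟨h1, h2⟩ : DescTo p B (k + 1) (c q)).anti (by omega)

/-- Going back from `p'` to `p` does not shorten decreasing subsequences with given last position,
to the left of the slide's right end. -/
theorem descTo_step (h : Slide p p' g c S r W) (hlow : LowCond p c S W) {B : Fin n → Prop}
    (hB : ∀ x y, x < y → B y → B x) (hBr : B r) {k : ℕ} {x y : Fin n}
    (hxy : Desc p' x y) (hy0 : y < c 0) (hx : DescTo p B k x) :
    DescTo p B (k + 1) y := by
  obtain ⟨hlt, hval⟩ := hxy
  have hle := h.val_apply_le (hlt.trans hy0).ne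
  suffices hs : p y < p x ∨ DescTo p B (k + 1) y by
    rcases hs with hs | hs
    · exact hx.cons (hB _ _ hs hx.head) ⟨hlt, hs⟩
    · exact hs
  rcases h.cases y with h0 | ⟨j, hj, rfl⟩ | hy
  · exact absurd h0 hy0.ne
  · rcases h.cases x with h0 | ⟨i, hi, rfl⟩ | hx'
    · exact absurd h0 (hlt.trans hy0).ne
    · left
      exact h.val _ _ (h.lt_of_pos (by omega) hlt) (by omega)
    · rw [h.apply_succ hj, h.apply_off hx'] at hval
      have hne : p x ≠ p (c (j + 1)) := fun he => hlt.ne (p.injective he)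
      rcases lt_or_gt_of_ne hne with hxj | hxj
      · right
        -- The critical case: `p x` lies between the values of `p` at `c j` and `c (j + 1)`, so `x`
        -- no longer tops `y` in `p`. But `x` can be followed by `c j`, which provides the tail of
        -- `j + 1` steps for the exchange.
        obtain ⟨w, hw, hjw, hxw, hcw⟩ := h.col_slot (by omega) hlt
        have hcx : w ≤ S → c (w + 1) < x := fun hwS =>
          lt_of_le_of_ne (hcw hwS) (hx' _ (by omega)).symm
        have hxc0 := hlt.trans hy0
        have hm : DescFrom p W (j + 1) x := (h.descFrom (i := j) (by omega)).cons
          (h.down _ _ hxc0 h.corner) ⟨hlt.trans (h.pos _ _ (by omega) (by omega)), hval⟩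
        have hxw' := hxj.trans_le (h.val_le hjw hw)
        by_cases hlq : w - (j + 1) ≤ k + 1
        · have h1 := h.low_col_exchange hlow hB hBr hw hxw hcx hxw' hx hm
            (l := k + 1 - (w - (j + 1))) (by omega)
          exact (h.descTo_add hB hjw hw h1).anti (by omega)
        · exact (h.descTo_add hB (k := 0) hjw hw (h.of_val hB hBr hw)).anti (by omega)
      · exact Or.inl hxj
  · left
    rw [h.apply_off hy] at hval
    exact hval.trans_le hle

theorem of_val' (h : Slide p p' g c S r W) {B : Fin n → Prop} (hB : ∀ x y, x < y → B y → B x)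
    {y : Fin n} {i : ℕ} (hi : i ≤ S) (hy : p (c i) < p' y) (hBy : B (p' y)) :
    B (p' (c (i + 1))) := by
  rw [h.apply_succ hi]
  exact hB _ _ hy hBy

theorem row_slot' (h : Slide p p' g c S r W) {x : Fin n} {j : ℕ} (hj : j ≤ S)
    (hx : c (j + 1) < x) (hv : p (c j) < p' x) :
    ∃ u ≤ S, j ≤ u ∧ c (u + 1) < x ∧ p (c u) < p' x ∧ (u < S → p' x ≤ p (c (u + 1))) := by
  obtain ⟨w, hw, hmax⟩ := Finset.exists_max_image
    ((Finset.range (S + 1)).filter fun i => p (c i) < p' x) id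
    ⟨j, by simp only [Finset.mem_filter, Finset.mem_range]; exact ⟨by omega, hv⟩⟩
  simp only [Finset.mem_filter, Finset.mem_range, id_eq] at hw hmax
  have hjw := hmax j ⟨by omega, hv⟩
  refine ⟨w, by omega, hjw, (h.pos_le (by omega) (by omega)).trans_lt hx, hw.2,
    fun hwS => not_lt.mp fun hlt => ?_⟩
  have := hmax (w + 1) ⟨by omega, hlt⟩
  omega

theorem descTo_snoc (h : Slide p p' g c S r W) {y : Fin n} {u : ℕ} (hu : u ≤ S)
    (hcy : c (u + 1) < y) (hyr : p' y < r) (hup : u < S → p' y ≤ p (c (u + 1))) :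
    DescTo p' (· < r) (S - u) y := by
  rcases hu.eq_or_lt with rfl | hu
  · rw [Nat.sub_self]
    exact hyr
  · have h1 := h.descTo' (i := u + 1) (by omega)
    have h2 : S - u = S - (u + 1) + 1 := by omega
    have h3 := (h.pos (u + 1) (u + 1 + 1) (by omega) (by omega)).trans hcy
    rw [h2]
    refine h1.cons hyr ⟨h3, lt_of_le_of_ne ?_ fun he => h3.ne' (p'.injective he)⟩
    rw [h.apply_succ hu]
    exact hup hu

/-- Counterpart of `low_row_exchange` in `p'`: now `y` lies above and to the right of the moved
entries, and the chains ending at `y` and at `c (u + 1)` swap heads. -/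
theorem up_row_exchange (h : Slide p p' g c S r W) {B : Fin n → Prop}
    (hB : ∀ x y, x < y → B y → B x) (hBr : ∀ x, B x → x < r) {k u : ℕ} {y : Fin n} (hu : u ≤ S)
    (hcy : c (u + 1) < y) (hvy : p (c u) < p' y) (hup : u < S → p' y ≤ p (c (u + 1)))
    (hy : DescTo p' B k y) :
    ∃ m l, DescTo p' (· < r) m y ∧ DescTo p' B l (c (u + 1)) ∧ l + m = k + (S - u) := by
  induction k generalizing y u with
  | zero =>
    exact ⟨S - u, 0, h.descTo_snoc hu hcy (hBr _ hy) hup, h.of_val' hB hu hvy hy, rfl⟩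
  | succ k ih =>
    have hBy := hy.head
    obtain ⟨-, z, ⟨hzy, hyz⟩, hz⟩ := hy
    have hvz := hvy.trans hyz
    rcases lt_or_ge (c (u + 1)) z with hcz | hzc
    · obtain ⟨w, hw, huw, hcz, hvz, hzup⟩ := h.row_slot' hu hcz hvz
      obtain ⟨m, l, hm, hl, hml⟩ := ih hw hcz hvz hzup hz
      exact ⟨m + 1, l + (w - u), hm.cons (hBr _ hBy) ⟨hzy, hyz⟩, h.descTo_add' hB huw hw hl,
        by omega⟩
    · have hne : z ≠ c (u + 1) := by
        rintro rfl
        rw [h.apply_succ hu] at hvz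
        exact lt_irrefl _ hvz
      refine ⟨S - u, k + 1, h.descTo_snoc hu hcy (hBr _ hBy) hup,
        hz.cons (h.of_val' hB hu hvy hBy) ⟨lt_of_le_of_ne hzc hne, ?_⟩, by omega⟩
      rwa [h.apply_succ hu]

/-- Going from `p` to `p'` does not shorten decreasing subsequences below `r` with given last
value. -/
theorem descTo_step' (h : Slide p p' g c S r W) (hup : UpCond p' c S r) {B : Fin n → Prop}
    (hB : ∀ x y, x < y → B y → B x) (hBr : ∀ x, B x → x < r) {k : ℕ} {x y : Fin n}
    (hxy : Desc p (g x) (g y)) (hx : DescTo p' B k x) : DescTo p' B (k + 1) y := by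
  obtain ⟨hlt, hval⟩ := hxy
  rw [← h.apply, ← h.apply] at hval
  have hxr := hBr _ hx.head
  have hxg := h.le_apply (h.ne_zero hxr.ne)
  suffices hs : x < y ∨ DescTo p' B (k + 1) y by
    rcases hs with hs | hs
    · exact hx.cons (hB _ _ hval hx.head) ⟨hs, hval⟩
    · exact hs
  rcases h.cases y with h0 | ⟨j, hj, rfl⟩ | hy
  · exact absurd h0 (h.ne_zero (hval.trans hxr).ne)
  · rw [h.shift j hj] at hlt
    rcases h.cases x with h0 | ⟨i, hi, rfl⟩ | hx'
    · exact absurd h0 (h.ne_zero hxr.ne)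
    · left
      rw [h.shift i hi] at hlt
      exact h.pos _ _ (by have := h.lt_of_pos (by omega) hlt; omega) (by omega)
    · rcases lt_or_gt_of_ne (hx' (j + 1) (by omega)) with hxj | hxj
      · exact Or.inl hxj
      · right
        rw [h.fixed x hx'] at hlt
        have hv := hval
        rw [h.apply_succ hj] at hv
        obtain ⟨u, hu, hju, hcx, hvx, hxup⟩ := h.row_slot' hj hxj hv
        obtain ⟨m, l, hm, hl, hml⟩ := h.up_row_exchange hB hBr hu hcx hvx hxup hx
        -- Here `x` has been passed by the entry moved to `c (j + 1)`. `UpCond` keeps chains ending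
        -- at `x` short, so the exchange makes the one ending at `c (j + 1)` long.
        have hmj : m < S - j := by
          by_contra hge
          exact hup j hj x hlt hval hxr (hm.anti (not_lt.mp hge))
        exact (h.descTo_add' hB hju hu hl).anti (by omega)
  · left
    rw [h.fixed y hy] at hlt
    exact hxg.trans_lt hlt

theorem col_slot' (h : Slide p p' g c S r W) {x : Fin n} {j : ℕ} (hj : j ≤ S)
    (hx : c (j + 1) < x) (hv : p (c j) < p' x) (hx0 : x < c 0) :
    ∃ q ≤ j, c (q + 1) < x ∧ x < c q ∧ p (c q) < p' x := by
  classical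
  have hex : ∃ v, c (v + 1) < x := ⟨j, hx⟩
  have hle : Nat.find hex ≤ j := Nat.find_min' hex hx
  have hvq := (h.val_le hle (by omega)).trans_lt hv
  refine ⟨Nat.find hex, hle, Nat.find_spec hex, ?_, hvq⟩
  rcases hq : Nat.find hex with _ | q
  · exact hx0
  · refine lt_of_le_of_ne (not_lt.mp (Nat.find_min hex (by omega))) ?_
    rintro rfl
    rw [hq, h.apply_succ (by omega)] at hvq
    have := h.lt_of_val (i := q + 1) (by omega) hvq
    omega

/-- Counterpart of `low_col_exchange` in `p'`: the chain is followed forwards from `y`, and the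
length `m` of a chain ending there grows along the way. -/
theorem up_col_exchange (h : Slide p p' g c S r W) (hup : UpCond p' c S r) {P : Fin n → Prop}
    (hP : ∀ x y, x < y → P y → P x) (hP0 : ∀ x, P x → x < c 0) {k q m : ℕ} {y : Fin n}
    (hq : q ≤ S) (hcy : c (q + 1) < y) (hyc : y < c q) (hvy : p (c q) < p' y)
    (hy : DescFrom p' P k y) (hm : DescTo p' (· < r) m y) {l : ℕ}
    (hl : l + (S - q) ≤ k + m + 1) :
    DescFrom p' P l (c (q + 1)) := by
  induction k generalizing y q m l with
  | zero =>
    have hmq : m < S - q := by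
      by_contra hge
      exact hup q hq y hyc (by rwa [h.apply_succ hq]) hm.head (hm.anti (not_lt.mp hge))
    obtain rfl : l = 0 := by omega
    exact hP _ _ hcy hy
  | succ k ih =>
    have hmq : m < S - q := by
      by_contra hge
      exact hup q hq y hyc (by rwa [h.apply_succ hq]) hm.head (hm.anti (not_lt.mp hge))
    have hPy := hy.head
    obtain ⟨-, z, ⟨hyz, hzy⟩, hz⟩ := hy
    have hcz := hcy.trans hyz
    rcases lt_or_ge (p (c q)) (p' z) with hvz | hzv
    · obtain ⟨w, hwq, hcz, hzc, hvz⟩ := h.col_slot' hq hcz hvz (hP0 _ hz.head)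
      have hm' : DescTo p' (· < r) (m + 1) z := hm.cons (hzy.trans hm.head) ⟨hyz, hzy⟩
      by_cases hlq : q - w ≤ l
      · have h1 := ih (by omega) hcz hzc hvz hz hm' (l := l - (q - w)) (by omega)
        exact (h.descFrom_add' hP hwq hq h1).anti (by omega)
      · exact (h.descFrom_add' (k := 0) hP hwq hq (hP _ _ hcz hz.head)).anti (by omega)
    · have hlt : p' z < p' (c (q + 1)) := by
        refine lt_of_le_of_ne (by rwa [h.apply_succ hq]) fun he => ?_
        exact hcz.ne' (p'.injective he)
      exact (hz.cons (hP _ _ hcy hPy) ⟨hcz, hlt⟩ :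
        DescFrom p' P (k + 1) (c (q + 1))).anti (by omega)

/-- Going from `p` to `p'` does not shorten decreasing subsequences with given first position,
to the left of the slide's right end. -/
theorem descFrom_step' (h : Slide p p' g c S r W) (hup : UpCond p' c S r) {P : Fin n → Prop}
    (hP : ∀ x y, x < y → P y → P x) (hP0 : ∀ x, P x → x < c 0) {k : ℕ} {x y : Fin n}
    (hxy : Desc p x y) (hy : DescFrom p' P k y) : DescFrom p' P (k + 1) x := by
  obtain ⟨hlt, hval⟩ := hxy
  have hy0 := hP0 _ hy.head
  have hle := h.val_apply_le hy0.ne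
  suffices hs : p' y < p' x ∨ DescFrom p' P (k + 1) x by
    rcases hs with hs | hs
    · exact hy.cons (hP _ _ hlt hy.head) ⟨hlt, hs⟩
    · exact hs
  rcases h.cases x with h0 | ⟨j, hj, rfl⟩ | hx
  · exact absurd h0 (hlt.trans hy0).ne
  · rcases h.cases y with h0 | ⟨i, hi, rfl⟩ | hy'
    · exact absurd h0 hy0.ne
    · left
      rw [h.apply_succ hi, h.apply_succ hj]
      have := h.lt_of_pos (by omega) hlt
      exact h.val _ _ (by omega) (by omega)
    · have hne : p' y ≠ p' (c (j + 1)) := fun he => hlt.ne' (p'.injective he)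
      rcases lt_or_gt_of_ne hne with hyj | hyj
      · exact Or.inl hyj
      · right
        have hyr : p' y < r := hle.trans_lt (hval.trans_le
          (h.top ▸ h.val_le (i := j + 1) (j := S + 1) (by omega) le_rfl))
        have hyj' := hyj
        rw [h.apply_succ hj] at hyj'
        obtain ⟨q, hqj, hcy, hyc, hvy⟩ := h.col_slot' hj hlt hyj' hy0
        have hm := h.descTo_snoc hj hlt hyr fun _ => by
          rw [h.apply_off hy']
          exact hval.le
        by_cases hlq : j - q ≤ k + 1
        · have h1 := h.up_col_exchange hup hP hP0 (by omega) hcy hyc hvy hy hm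
            (l := k + 1 - (j - q)) (by omega)
          exact (h.descFrom_add' hP hqj hj h1).anti (by omega)
        · exact (h.descFrom_add' (k := 0) hP hqj hj (hP _ _ hcy hy.head)).anti (by omega)
  · left
    rw [h.apply_off hx]
    exact hle.trans_lt hval

end Slide

end Slides

/-! ### Boards, and what a slide does to occurrences with other tops. -/

section Boards

variable {n : ℕ}

/-- `D` is a board: with a cell it contains all cells weakly to the left and below. -/
def IsBoard (D : Fin n → Fin n → Prop) : Prop :=
  ∀ x y u v, x ≤ y → u ≤ v → D y v → D x u

/-- In the board `D`, `p` has a decreasing subsequence with `S + 2` entries, the largest of them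
being `r`. -/
def HasDesc (D : Fin n → Fin n → Prop) (S : ℕ) (p : Equiv.Perm (Fin n)) (r : Fin n) : Prop :=
  ∃ x, p x = r ∧ DescFrom p (fun z => D z r) (S + 1) x

/-- In the board `D`, `p` has a decreasing subsequence with `S + 1` entries that is followed by
the larger entry `r`. -/
def HasDescMax (D : Fin n → Fin n → Prop) (S : ℕ) (p : Equiv.Perm (Fin n)) (r : Fin n) : Prop :=
  ∃ x, p x = r ∧ D x r ∧ ∃ y < x, DescTo p (· < r) S y

variable {p p' g : Equiv.Perm (Fin n)} {c : ℕ → Fin n} {S : ℕ} {r : Fin n}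
  {D : Fin n → Fin n → Prop}

theorem IsBoard.left (hD : IsBoard D) {v : Fin n} (x y : Fin n) (hxy : x < y) (h : D y v) :
    D x v := hD _ _ _ _ hxy.le le_rfl h

theorem HasDesc.of_join (hD : IsBoard D) {v x : Fin n} {k l : ℕ}
    (h₁ : DescTo p (· ≤ v) k x) (h₂ : DescFrom p (fun z => D z v) l x) (hkl : S + 1 ≤ k + l) :
    ∃ w ≤ v, HasDesc D S p w := by
  obtain ⟨y, hyv, hy⟩ := ChainFrom.join (fun a b hab hb => hD.left a b hab.1 hb) h₁ h₂
  exact ⟨p y, hyv, y, rfl, (hy.anti hkl).mono fun z hz => hD _ _ _ _ le_rfl hyv hz⟩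

namespace Slide

theorem descFrom_of_descFrom' (hD : IsBoard D) (h : Slide p p' g c S r (D · r))
    (hlow : LowCond p c S (D · r)) {k : ℕ} {x v : Fin n} (hvr : v ≤ r) (hxr : p' x < r)
    (hx : DescFrom p' (D · v) k x) : DescFrom p (D · v) k (g x) := by
  have hc0 : D (c 0) v := hD _ _ _ _ le_rfl hvr h.corner
  induction k generalizing x with
  | zero =>
    change D (g x) v
    rcases h.cases x with h0 | ⟨i, hi, rfl⟩ | hx'
    · exact absurd h0 (h.ne_zero hxr.ne)
    · rw [h.shift i hi]
      exact h.of_pos hD.left hc0 (by omega)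
    · rwa [h.fixed x hx']
  | succ k ih =>
    obtain ⟨-, y, hxy, hy⟩ := hx
    exact h.descFrom_step hlow hD.left hc0 hxy hxr (ih (hxy.2.trans hxr) hy)

theorem hasDesc_of_hasDesc' (hD : IsBoard D) (h : Slide p p' g c S r (D · r))
    (hlow : LowCond p c S (D · r)) {v : Fin n} (hvr : v < r) (hv : HasDesc D S p' v) :
    HasDesc D S p v := by
  obtain ⟨x, rfl, hx⟩ := hv
  exact ⟨g x, (h.apply x).symm, h.descFrom_of_descFrom' hD hlow hvr.le hvr hx⟩

theorem descTo_of_descTo' (h : Slide p p' g c S r (D · r))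
    (hlow : LowCond p c S (D · r)) {b : Fin n} (hrb : r < b) {k : ℕ} {y : Fin n} (hy0 : y < c 0)
    (hy : DescTo p' (· < b) k y) : DescTo p (· < b) k y := by
  induction k generalizing y with
  | zero =>
    change p y < b
    rcases h.cases y with h0 | ⟨i, hi, rfl⟩ | hy'
    · exact absurd h0 hy0.ne
    · exact h.of_val (B := (· < b)) (fun x y hxy hy => hxy.trans hy) hrb (by omega)
    · rw [← h.apply_off hy']
      exact hy
  | succ k ih =>
    obtain ⟨-, x, hxy, hx⟩ := hy
    exact h.descTo_step hlow (fun x y hxy hy => hxy.trans hy) hrb hxy hy0 (ih (hxy.1.trans hy0) hx)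

theorem apply_of_gt (h : Slide p p' g c S r (D · r)) {x : Fin n} (hx : r < p x) : p' x = p x := by
  apply h.apply_off
  rintro i hi rfl
  exact absurd (h.top ▸ h.val_le hi le_rfl) (not_le.mpr hx)

theorem apply_of_gt' (h : Slide p p' g c S r (D · r)) {x : Fin n} (hx : r < p' x) :
    p' x = p x := by
  apply h.apply_of_gt
  refine hx.trans_le (h.val_apply_le (h.ne_zero hx.ne'))

theorem ne_zero_of_gt (h : Slide p p' g c S r (D · r)) {x : Fin n} (hx : r < p x) : x ≠ c 0 := by
  rintro rfl
  exact absurd (h.top ▸ h.val_le (Nat.zero_le (S + 1)) le_rfl) (not_le.mpr hx)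

theorem hasDescMax_of_hasDescMax' (h : Slide p p' g c S r (D · r))
    (hlow : LowCond p c S (D · r)) {b : Fin n} (hrb : r < b) (hb : HasDescMax D S p' b) :
    HasDescMax D S p b := by
  obtain ⟨x, rfl, hDx, y, hyx, hy⟩ := hb
  have hpx := h.apply_of_gt' hrb
  refine ⟨x, hpx.symm, hDx, ?_⟩
  rcases lt_or_gt_of_ne (h.ne_zero hrb.ne') with hx0 | hx0
  · exact ⟨y, hyx, h.descTo_of_descTo' hlow hrb (hyx.trans hx0) hy⟩
  -- To the right of the slide, its own `S + 2` entries in `p`, all at most `r < b`, already provide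
  -- the decreasing part.
  · refine ⟨c 0, hx0, ?_⟩
    have h0 : DescTo p (· < p' x) 0 (c (S + 1)) := by
      change p _ < _
      rwa [h.top]
    exact (h.descTo_add (fun x y hxy hy => hxy.trans hy) (Nat.zero_le (S + 1)) le_rfl h0).anti
      (by omega)

/-- A chain of `p` is traversed forwards while a chain of `p'` ending at the corresponding entry is
prolonged. The chain of `p'` may be rerouted on the way, so only the bound `B` on its values and the
bound `P` on its last position survive. -/
theorem descTo'_of_descFrom (h : Slide p p' g c S r (D · r)) (hup : UpCond p' c S r)
    {B P : Fin n → Prop} (hB : ∀ x y, x < y → B y → B x) (hBr : ∀ x, B x → x < r)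
    (hP : ∀ x y, x < y → P y → P x) {k m : ℕ} {x : Fin n} (hx' : DescTo p' B k x)
    (hx : DescFrom p P m (g x)) : ∃ y, P y ∧ DescTo p' B (k + m) y := by
  induction m generalizing k x with
  | zero =>
    have hle := h.le_apply (h.ne_zero (hBr _ hx'.head).ne)
    refine ⟨x, ?_, hx'⟩
    rcases hle.eq_or_lt with he | hlt
    · rw [he]
      exact hx.head
    · exact hP _ _ hlt hx.head
  | succ m ih =>
    obtain ⟨-, y, hxy, hy⟩ := hx
    obtain ⟨y, rfl⟩ := g.surjective y
    obtain ⟨z, hz, hz'⟩ := ih (h.descTo_step' hup hB hBr hxy hx') hy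
    exact ⟨z, hz, by rwa [Nat.add_assoc, Nat.add_comm 1] at hz'⟩

/-- The top may drop because of rerouting; this is harmless, since absence is required for all tops
below `r`. -/
theorem hasDesc'_of_hasDesc (hD : IsBoard D) (h : Slide p p' g c S r (D · r))
    (hup : UpCond p' c S r) {v : Fin n} (hvr : v < r) (hv : HasDesc D S p v) :
    ∃ w ≤ v, HasDesc D S p' w := by
  obtain ⟨x, rfl, hx⟩ := hv
  obtain ⟨x, rfl⟩ := g.surjective x
  obtain ⟨y, hy, hy'⟩ := h.descTo'_of_descFrom hup (B := (· ≤ p (g x))) (k := 0)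
    (fun x y hxy hy => hxy.le.trans hy) (fun y hy => hy.trans_lt hvr) hD.left
    (h.apply x).le hx
  exact HasDesc.of_join hD hy' (l := 0) hy (by omega)

theorem descFrom'_of_descFrom (h : Slide p p' g c S r (D · r)) (hup : UpCond p' c S r)
    {P : Fin n → Prop} (hP : ∀ x y, x < y → P y → P x) (hP0 : ∀ x, P x → x < c 0) {k : ℕ}
    {x : Fin n} (hx : DescFrom p P k x) : DescFrom p' P k x := by
  induction k generalizing x with
  | zero => exact hx
  | succ k ih =>
    obtain ⟨-, y, hxy, hy⟩ := hx
    exact h.descFrom_step' hup hP hP0 hxy (ih hy)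

theorem hasDescMax'_of_hasDescMax (h : Slide p p' g c S r (D · r)) (hup : UpCond p' c S r)
    {b : Fin n} (hrb : r < b) (hb : HasDescMax D S p b) : HasDescMax D S p' b := by
  obtain ⟨x, rfl, hDx, y, hyx, hy⟩ := hb
  refine ⟨x, h.apply_of_gt hrb, hDx, ?_⟩
  rcases lt_or_gt_of_ne (h.ne_zero_of_gt hrb) with hx0 | hx0
  -- The chain is re-anchored at its first position `w`, which `descFrom'_of_descFrom` preserves.
  -- The value at `w` can only decrease, so it stays below the top.
  · obtain ⟨w, hw, hw'⟩ := ChainFrom.join (R := Desc p) (P := (· < x)) (m := 0)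
      (fun a b hab hb => hab.1.trans hb) hy hyx
    have h1 := h.descFrom'_of_descFrom hup (fun a b hab hb => hab.trans hb)
      (fun a ha => ha.trans hx0) hw'
    have hwx : w < x := hw'.head
    have h0 : p' w < p x :=
      (h.val_apply_le (hwx.trans hx0).ne).trans_lt hw
    obtain ⟨z, hz, hz'⟩ := ChainFrom.join (R := fun y x => Desc p' x y) (m := 0)
      (P := fun a => p' a < p x)
      (fun a b hab hb => hab.2.trans hb) h1 h0
    exact ⟨z, hz, hz'⟩
  · exact ⟨c 1, (h.pos 0 1 (by omega) (by omega)).trans hx0,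
      (h.descTo' (Nat.zero_le S)).mono fun z hz => lt_trans hz hrb⟩

/-- The slide of the greedy decreasing subsequence can be undone greedily. -/
theorem upCond (hD : IsBoard D) (h : Slide p p' g c S r (D · r)) (hlow : LowCond p c S (D · r)) :
    UpCond p' c S r := by
  -- A violating `y` would give, in `p`, a chain of `q + 1` steps from `g y` through the slide.
  -- Pulling back the `S - q` steps that lead to `y` in `p'` prolongs it to `S + 1` steps with top
  -- below `r`, against `LowCond` at `q = S + 1`.
  intro q hq y hyc hcy hyr hy
  have hW : D (g y) r ∧ DescFrom p (D · r) (q + 1) (g y) := by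
    have hfrom : DescFrom p (D · r) (q + 1) (g y) := by
      rcases h.cases y with h0 | ⟨i, hi, rfl⟩ | hy'
      · exact absurd h0 (h.ne_zero hyr.ne)
      · rw [h.apply_succ hi, h.apply_succ hq] at hcy
        have := h.lt_of_val (by omega) hcy
        rw [h.shift i hi]
        exact (h.descFrom (by omega)).anti (by omega)
      · rw [h.fixed y hy']
        rw [h.apply_succ hq, h.apply_off hy'] at hcy
        exact (h.descFrom (by omega)).cons
          (hD.left _ _ (hyc.trans_le (h.pos_le (Nat.zero_le q) (by omega))) h.corner) ⟨hyc, hcy⟩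
    exact ⟨hfrom.head, hfrom⟩
  have key : ∀ k m y, DescTo p' (· < r) k y → DescFrom p (D · r) m (g y) →
      ∃ x, p' x < r ∧ DescFrom p (D · r) (m + k) (g x) := by
    intro k
    induction k with
    | zero => exact fun m y hy hm => ⟨y, hy, hm⟩
    | succ k ih =>
      rintro m y ⟨-, x, hxy, hx⟩ hm
      obtain ⟨z, hz, hz'⟩ := ih (m + 1) x hx
        (h.descFrom_step hlow hD.left h.corner hxy hx.head hm)
      exact ⟨z, hz, by rwa [Nat.add_assoc, Nat.add_comm 1] at hz'⟩
  obtain ⟨x, hx, hx'⟩ := key _ _ y hy hW.2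
  refine hlow (S + 1) le_rfl (g x) (fun hS => absurd hS (by omega)) ?_ (hx'.anti (by omega))
  rwa [h.top, ← h.apply]

theorem lowCond (hD : IsBoard D) (h : Slide p p' g c S r (D · r)) (hup : UpCond p' c S r)
    (hJ : ∀ v < r, ¬ HasDesc D S p' v) : LowCond p c S (D · r) := by
  intro q hq y hcy hyv hy
  obtain ⟨y, rfl⟩ := g.surjective y
  have hyr : p (g y) < r := hyv.trans_le (h.top ▸ h.val_le hq le_rfl)
  have hyr' := hyr
  rw [← h.apply] at hyr'
  -- In `p'` the moved entries up to `c (q + 1)` lead to `y`. Following the `q` steps from `g y` in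
  -- `p` then yields `S + 1` steps in `p'` with top below `r`, which `hJ` forbids.
  have hto : DescTo p' (· < r) (S + 1 - q) y := by
    rcases hq.eq_or_lt with rfl | hqS
    · rw [Nat.sub_self]
      exact hyr'
    · have hqS : q ≤ S := by omega
      have h2 : S + 1 - q = S - q + 1 := by omega
      rcases h.cases y with h0 | ⟨i, hi, rfl⟩ | hy'
      · exact absurd h0 (h.ne_zero hyr'.ne)
      · rw [h.shift i hi] at hyv
        have := h.lt_of_val (by omega) hyv
        exact (h.descTo' hi).anti (by omega)
      · rw [h2]
        have hcy := hcy hqS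
        rw [h.fixed y hy'] at hcy hyv
        refine (h.descTo' hqS).cons hyr' ⟨hcy, ?_⟩
        rwa [h.apply_succ hqS, h.apply_off hy']
  obtain ⟨z, hz, hz'⟩ := h.descTo'_of_descFrom hup (fun a b hab hb => hab.trans hb)
    (fun a ha => ha) hD.left hto hy
  obtain ⟨x, hxr, hx⟩ := ChainFrom.join (R := Desc p') (P := (D · r)) (m := 0)
    (fun a b hab hb => hD.left a b hab.1 hb) hz' hz
  exact hJ _ hxr ⟨x, rfl, (hx.anti (by omega)).mono fun a ha => hD _ _ _ _ le_rfl hxr.le ha⟩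

end Slide

/-! ### Greedy slides: existence, uniqueness and the resulting count. -/

variable {W : Fin n → Prop}

theorem Desc.trans {x y z : Fin n} (h₁ : Desc p x y) (h₂ : Desc p y z) : Desc p x z :=
  ⟨h₁.1.trans h₂.1, h₂.2.trans h₁.2⟩

theorem Desc.of_succ {k : ℕ} (hc : ∀ i < k, Desc p (c (i + 1)) (c i)) {i j : ℕ} (hij : i < j)
    (hj : j ≤ k) : Desc p (c j) (c i) := by
  induction j, hij using Nat.le_induction with
  | base => exact hc i (by omega)
  | succ j _ ih => exact (hc j (by omega)).trans (ih (by omega))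

theorem Slide.exists_right (hW : ∀ x y, x < y → W y → W x)
    (hc : ∀ i < S + 1, Desc p (c (i + 1)) (c i)) (hr : p (c (S + 1)) = r) (h0 : W (c 0)) :
    ∃ p' g, Slide p p' g c S r W ∧ Equiv.Perm.sign g = (-1) ^ (S + 1) := by
  have hd := fun i j hij hj => Desc.of_succ (k := S + 1) hc (i := i) (j := j) hij hj
  obtain ⟨g, h1, h2, h3, h4⟩ := exists_cycle c (S + 1) fun i j hij hj => (hd i j hij hj).1.ne'
  exact ⟨p * g, g, ⟨fun i j hij hj => (hd i j hij hj).1, fun i j hij hj => (hd i j hij hj).2, hr,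
    fun i hi => h1 i (by omega), h2, h3, fun x => rfl, h0, hW⟩, h4⟩

theorem Slide.exists_left (hW : ∀ x y, x < y → W y → W x) (hpos : c 1 < c 0)
    (hc : ∀ i < S, Desc p' (c (i + 2)) (c (i + 1))) (hr : p' (c 0) = r) (h0 : W (c 0))
    (hS : p' (c (S + 1)) < r) :
    ∃ p g, Slide p p' g c S r W ∧ Equiv.Perm.sign g = (-1) ^ (S + 1) := by
  have hd := fun i j hij hj =>
    Desc.of_succ (k := S) (c := fun i => c (i + 1)) hc (i := i) (j := j) hij hj
  have hlt : ∀ i j, i < j → j ≤ S + 1 → c j < c i := by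
    intro i j hij hj
    obtain ⟨j, rfl⟩ : ∃ k, j = k + 1 := ⟨j - 1, by omega⟩
    rcases i with _ | i
    · rcases j with _ | j
      · exact hpos
      · exact (hd 0 (j + 1) (by omega) (by omega)).1.trans hpos
    · exact (hd i j (by omega) (by omega)).1
  obtain ⟨g, h1, h2, h3, h4⟩ := exists_cycle c (S + 1) fun i j hij hj => (hlt i j hij hj).ne'
  have hp : ∀ i ≤ S, (p' * g⁻¹) (c i) = p' (c (i + 1)) := fun i hi => by
    simp [← h1 i (by omega)]
  have hp' : (p' * g⁻¹) (c (S + 1)) = r := by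
    simp [← h2, hr]
  refine ⟨p' * g⁻¹, g, ⟨hlt, ?_, hp', fun i hi => h1 i (by omega), h2, h3, fun x => by simp, h0,
    hW⟩, h4⟩
  intro i j hij hj
  rw [hp i (by omega)]
  rcases Nat.lt_or_eq_of_le hj with hj | rfl
  · rw [hp j (by omega)]
    exact (hd i j hij (by omega)).2
  · rw [hp']
    rcases (Nat.le_of_lt_succ hij).eq_or_lt with rfl | hi
    · exact hS
    · exact (hd i S hi le_rfl).2.trans hS

theorem Slide.exists_lowCond (hD : IsBoard D) (hr : HasDesc D S p r)
    (hJ : ∀ v < r, ¬ HasDesc D S p v) :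
    ∃ p' g c, Slide p p' g c S r (D · r) ∧ LowCond p c S (D · r) ∧
      Equiv.Perm.sign g = (-1) ^ (S + 1) := by
  obtain ⟨x, rfl, hx⟩ := hr
  obtain ⟨c, rfl, hc0, hc⟩ := hx.exists_greedy p
  obtain ⟨p', g, h, hs⟩ := Slide.exists_right (W := (D · (p (c (S + 1))))) hD.left
    (fun i hi => (hc i hi).1) rfl (hc0 0 (by omega))
  refine ⟨p', g, c, h, ?_, hs⟩
  intro q hq y hcy hyv hy
  rcases hq.eq_or_lt with rfl | hq
  -- For `q = S + 1` there is no `c (q + 1)`, and `LowCond` is the absence of occurrences with top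
  -- below `r`.
  · exact hJ _ hyv ⟨y, rfl, hy.mono fun a ha => hD _ _ _ _ le_rfl hyv.le ha⟩
  · exact (hc q hq).2 y ⟨hcy (by omega), hyv.trans (hc q hq).1.2⟩ hyv hy

/-- Going left from `r`, the largest admissible value is taken each time, first for the end of the
decreasing part and then by `exists_greedy` for the reversed order. The greedy chain `e` is numbered
from its far end, hence `c i = e (S + 1 - i)` for `i > 0`. -/
theorem Slide.exists_upCond (hD : IsBoard D) (hr : HasDescMax D S p' r) :
    ∃ p g c, Slide p p' g c S r (D · r) ∧ UpCond p' c S r ∧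
      Equiv.Perm.sign g = (-1) ^ (S + 1) := by
  obtain ⟨x, hxr, hDx, hy⟩ := hr
  obtain ⟨y, ⟨hyx, hy⟩, hmax⟩ := Set.exists_max_image {y | y < x ∧ DescTo p' (· < r) S y} p'
    (Set.toFinite _) hy
  obtain ⟨e, rfl, he0, he⟩ := hy.exists_greedy fun x => OrderDual.toDual (p' x)
  have hc1 : ∀ i, (fun i => if i = 0 then x else e (S + 1 - i)) (i + 1) = e (S - i) := by
    intro i
    simp only [Nat.add_eq_zero_iff, one_ne_zero, and_false, if_false]
    congr 1
    omega
  generalize hc : (fun i => if i = 0 then x else e (S + 1 - i)) = c at hc1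
  have hc0 : c 0 = x := by simp [← hc]
  have hdesc : ∀ i < S, Desc p' (c (i + 2)) (c (i + 1)) := fun i hi => by
    rw [hc1 (i + 1), hc1]
    have := (he (S - (i + 1)) (by omega)).1
    rwa [show S - (i + 1) + 1 = S - i by omega] at this
  obtain ⟨p, g, h, hs⟩ := Slide.exists_left (W := (D · r)) (p' := p') (c := c) (S := S) hD.left
    (by rw [hc1, hc0]; exact hyx) hdesc (by rw [hc0, hxr]) (by rwa [hc0])
    (by rw [hc1]; exact (he0 _ (by omega)).head)
  refine ⟨p, g, c, h, ?_, hs⟩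
  intro q hq y hyc hcy hyr hy
  rcases q with _ | q
  · rw [hc1] at hcy
    rw [hc0] at hyc
    exact absurd (hmax y ⟨hyc, hy⟩) (not_le.mpr hcy)
  · have hd := (hdesc q (by omega)).2
    have h1 := (he (S - (q + 1)) (by omega)).2 y
    rw [show S - (q + 1) + 1 = S - q by omega, ← hc1, ← hc1] at h1
    exact h1 ⟨hyc, hd.trans hcy⟩ hcy hy

theorem Slide.eq_of_chain_eq {p₁ p₂ p₁' p₂' g₁ g₂ : Equiv.Perm (Fin n)} {c₁ c₂ : ℕ → Fin n}
    (h₁ : Slide p₁ p₁' g₁ c₁ S r W) (h₂ : Slide p₂ p₂' g₂ c₂ S r W)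
    (hc : ∀ i ≤ S + 1, c₁ i = c₂ i) : g₁ = g₂ := by
  ext x : 1
  rcases h₁.cases x with rfl | ⟨i, hi, rfl⟩ | hx
  · rw [h₁.shift_zero, hc 0 (by omega), h₂.shift_zero, hc _ le_rfl]
  · rw [h₁.shift i hi, hc i (by omega), hc (i + 1) (by omega), h₂.shift i hi]
  · rw [h₁.fixed x hx, h₂.fixed x fun i hi => hc i hi ▸ hx i hi]

/-- Both chains start at the position of `r`. Where they first differ, the lower entry contradicts
`LowCond` for the other chain. -/
theorem Slide.unique_right {p₁' p₂' g₁ g₂ : Equiv.Perm (Fin n)} {c₁ c₂ : ℕ → Fin n}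
    (h₁ : Slide p p₁' g₁ c₁ S r W) (h₂ : Slide p p₂' g₂ c₂ S r W) (hl₁ : LowCond p c₁ S W)
    (hl₂ : LowCond p c₂ S W) : p₁' = p₂' := by
  have hc : ∀ d ≤ S + 1, c₁ (S + 1 - d) = c₂ (S + 1 - d) := by
    intro d
    induction d with
    | zero => exact fun _ => p.injective (h₁.top.trans h₂.top.symm)
    | succ d ih =>
      intro hd
      have ih := ih (by omega)
      obtain ⟨q, hq, h1⟩ : ∃ q ≤ S, S + 1 - d = q + 1 := ⟨S - d, by omega, by omega⟩
      rw [h1] at ih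
      rw [show S + 1 - (d + 1) = q by omega]
      by_contra hne
      rcases lt_or_gt_of_ne (p.injective.ne hne) with hlt | hlt
      · exact hl₂ q (by omega) _ (fun _ => ih ▸ h₁.pos q (q + 1) (by omega) (by omega)) hlt
          (h₁.descFrom (by omega))
      · exact hl₁ q (by omega) _ (fun _ => ih ▸ h₂.pos q (q + 1) (by omega) (by omega)) hlt
          (h₂.descFrom (by omega))
  have hg := h₁.eq_of_chain_eq h₂ fun i hi => by
    simpa [Nat.sub_sub_self hi] using hc (S + 1 - i) (by omega)
  ext x : 1
  rw [h₁.apply, h₂.apply, hg]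

theorem Slide.unique_left {p₁ p₂ g₁ g₂ : Equiv.Perm (Fin n)} {c₁ c₂ : ℕ → Fin n}
    (h₁ : Slide p₁ p' g₁ c₁ S r W) (h₂ : Slide p₂ p' g₂ c₂ S r W) (hu₁ : UpCond p' c₁ S r)
    (hu₂ : UpCond p' c₂ S r) : p₁ = p₂ := by
  have hc : ∀ q ≤ S + 1, c₁ q = c₂ q := by
    intro q
    induction q with
    | zero => exact fun _ => p'.injective (h₁.apply_zero.trans h₂.apply_zero.symm)
    | succ q ih =>
      intro hq
      have ih := ih (by omega)
      by_contra hne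
      rcases lt_or_gt_of_ne (p'.injective.ne hne) with hlt | hlt
      · refine hu₁ q (by omega) _ (ih ▸ h₂.pos q (q + 1) (by omega) (by omega)) hlt ?_
          (h₂.descTo' (by omega))
        exact (h₂.descTo' (i := q) (by omega)).head
      · refine hu₂ q (by omega) _ (ih ▸ h₁.pos q (q + 1) (by omega) (by omega)) hlt ?_
          (h₁.descTo' (by omega))
        exact (h₁.descTo' (i := q) (by omega)).head
  have hg := h₁.eq_of_chain_eq h₂ hc
  ext x : 1
  obtain ⟨x, rfl⟩ := g₁.surjective x
  rw [← h₁.apply, hg, ← h₂.apply]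

/-- `p` and `p'` differ only in entries that lie in cells of `D`. -/
def AgreeOutside (D : Fin n → Fin n → Prop) (p p' : Equiv.Perm (Fin n)) : Prop :=
  ∀ x, p x = p' x ∨ D x (p x) ∧ D x (p' x)

theorem AgreeOutside.symm (h : AgreeOutside D p p') : AgreeOutside D p' p :=
  fun x => (h x).imp Eq.symm And.symm

theorem Slide.agreeOutside (hD : IsBoard D) (h : Slide p p' g c S r (D · r)) :
    AgreeOutside D p p' := by
  have hp : ∀ i ≤ S + 1, D (c i) (p (c i)) := fun i hi =>
    hD _ _ _ _ (h.pos_le (Nat.zero_le i) hi) (h.top ▸ h.val_le hi le_rfl) h.corner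
  intro x
  rcases h.cases x with rfl | ⟨i, hi, rfl⟩ | hx
  · right
    exact ⟨hp 0 (by omega), h.apply_zero ▸ h.corner⟩
  · right
    refine ⟨hp _ (by omega), hD _ _ _ _ le_rfl ?_ (hp _ (by omega))⟩
    rw [h.apply_succ hi]
    exact h.val_le (by omega) (by omega)
  · exact Or.inl (h.apply_off hx).symm

theorem Slide.hasDescMax (h : Slide p p' g c S r (D · r)) : HasDescMax D S p' r :=
  ⟨c 0, h.apply_zero, h.corner, c 1, h.pos 0 1 (by omega) (by omega), h.descTo' (Nat.zero_le S)⟩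

theorem Slide.hasDesc (h : Slide p p' g c S r (D · r)) : HasDesc D S p r :=
  ⟨c (S + 1), h.top, h.descFrom le_rfl⟩

theorem ncard_le_ncard_of_rel {α β : Type*} [Finite β] [Nonempty β] {s : Set α} {t : Set β}
    (R : α → β → Prop) (hR : ∀ a ∈ s, ∃ b ∈ t, R a b)
    (hinj : ∀ a₁ a₂ b, R a₁ b → R a₂ b → a₁ = a₂) : s.ncard ≤ t.ncard := by
  choose! f hft hfR using hR
  refine Set.ncard_le_ncard_of_injOn f hft fun a₁ h₁ a₂ h₂ he => ?_
  exact hinj a₁ a₂ (f a₁) (hfR a₁ h₁) (he ▸ hfR a₂ h₂)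

/-- A set of permutations that is closed under changes inside the board that keep the sign. -/
def ClosedInside (D : Fin n → Fin n → Prop) (K : Set (Equiv.Perm (Fin n))) : Prop :=
  ∀ p p', AgreeOutside D p p' → Equiv.Perm.sign p = Equiv.Perm.sign p' → p ∈ K → p' ∈ K

/-- The relation "a slide satisfying both `LowCond` and `UpCond` leads from `p` to `p'`" is
injective in both directions and total on both sets, so each cardinality bounds the other. Oddness
of `S` is needed only for the sign of the cycle. -/
theorem ncard_hasDesc_eq (hS : Odd S) (hD : IsBoard D) {K : Set (Equiv.Perm (Fin n))}
    (hK : ClosedInside D K) (r : Fin n) :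
    ({p | p ∈ K ∧ (∀ v < r, ¬ HasDesc D S p v) ∧ ∀ v > r, ¬ HasDescMax D S p v} ∩
        {p | HasDesc D S p r}).ncard =
      ({p | p ∈ K ∧ (∀ v < r, ¬ HasDesc D S p v) ∧ ∀ v > r, ¬ HasDescMax D S p v} ∩
        {p | HasDescMax D S p r}).ncard := by
  have hsign : ∀ {p p' g : Equiv.Perm (Fin n)} {c : ℕ → Fin n}, Slide p p' g c S r (D · r) →
      Equiv.Perm.sign g = (-1) ^ (S + 1) → Equiv.Perm.sign p' = Equiv.Perm.sign p := by
    intro p p' g c h hg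
    have hp' : p' = p * g := Equiv.ext h.apply
    rw [hp', Equiv.Perm.sign_mul, hg, hS.add_one.neg_one_pow, mul_one]
  let R : Equiv.Perm (Fin n) → Equiv.Perm (Fin n) → Prop := fun p p' => ∃ g c,
    Slide p p' g c S r (D · r) ∧ LowCond p c S (D · r) ∧ UpCond p' c S r
  apply le_antisymm
  · refine ncard_le_ncard_of_rel R ?_ ?_
    · rintro p ⟨⟨hpK, hJ, hF⟩, hr⟩
      obtain ⟨p', g, c, h, hlow, hg⟩ := Slide.exists_lowCond hD hr hJ
      refine ⟨p', ⟨⟨hK p p' (h.agreeOutside hD) (hsign h hg).symm hpK, ?_, ?_⟩, h.hasDescMax⟩,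
        g, c, h, hlow, h.upCond hD hlow⟩
      · exact fun v hv hv' => hJ v hv (h.hasDesc_of_hasDesc' hD hlow hv hv')
      · exact fun v hv hv' => hF v hv (h.hasDescMax_of_hasDescMax' hlow hv hv')
    · rintro p₁ p₂ p' ⟨g₁, c₁, h₁, -, hu₁⟩ ⟨g₂, c₂, h₂, -, hu₂⟩
      exact h₁.unique_left h₂ hu₁ hu₂
  · refine ncard_le_ncard_of_rel (fun p' p => R p p') ?_ ?_
    · rintro p' ⟨⟨hpK, hJ, hF⟩, hr⟩
      obtain ⟨p, g, c, h, hup, hg⟩ := Slide.exists_upCond hD hr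
      refine ⟨p, ⟨⟨hK p' p (h.agreeOutside hD).symm (hsign h hg) hpK, ?_, ?_⟩, h.hasDesc⟩,
        g, c, h, h.lowCond hD hup hJ, hup⟩
      · intro v hv hv'
        obtain ⟨w, hw, hw'⟩ := h.hasDesc'_of_hasDesc hD hup hv hv'
        exact hJ w (hw.trans_lt hv) hw'
      · exact fun v hv hv' => hF v hv (h.hasDescMax'_of_hasDescMax hup hv hv')
    · rintro p₁' p₂' p ⟨g₁, c₁, h₁, hl₁, -⟩ ⟨g₂, c₂, h₂, hl₂, -⟩
      exact h₁.unique_right h₂ hl₁ hl₂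

/-- On every board, as many permutations of each sign avoid `(S + 2) ⋯ 1` as avoid
`(S + 1) ⋯ 1 (S + 2)`, if `S` is odd. -/
theorem ncard_board_avoiders_eq (hS : Odd S) (hD : IsBoard D) {K : Set (Equiv.Perm (Fin n))}
    (hK : ClosedInside D K) :
    {p | p ∈ K ∧ ∀ v, ¬ HasDesc D S p v}.ncard = {p | p ∈ K ∧ ∀ v, ¬ HasDescMax D S p v}.ncard := by
  -- The sweep. Consecutive sets arise from a common set `Y` by removing the permutations having,
  -- respectively, a `HasDescMax` or a `HasDesc` occurrence with top `m`; the removed parts are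
  -- equinumerous.
  have key : ∀ m ≤ n, {p | p ∈ K ∧ (∀ v : Fin n, v.val < m → ¬ HasDesc D S p v) ∧
      ∀ v : Fin n, m ≤ v.val → ¬ HasDescMax D S p v}.ncard =
      {p | p ∈ K ∧ ∀ v, ¬ HasDescMax D S p v}.ncard := by
    intro m
    induction m with
    | zero => simp
    | succ m ih =>
      intro hm
      rw [← ih (by omega)]
      have h1 := ncard_hasDesc_eq hS hD hK ⟨m, hm⟩
      generalize hY : {p | p ∈ K ∧ (∀ v < (⟨m, hm⟩ : Fin n), ¬ HasDesc D S p v) ∧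
        ∀ v > (⟨m, hm⟩ : Fin n), ¬ HasDescMax D S p v} = Y at h1
      have h2 := Set.ncard_inter_add_ncard_sdiff_eq_ncard Y {p | HasDesc D S p ⟨m, hm⟩}
      have h3 := Set.ncard_inter_add_ncard_sdiff_eq_ncard Y {p | HasDescMax D S p ⟨m, hm⟩}
      have hsplit : ∀ v : Fin n, v.val < m + 1 ↔ v < ⟨m, hm⟩ ∨ v = ⟨m, hm⟩ := fun v => by
        rw [Fin.lt_def, Fin.ext_iff]
        simp only
        omega
      have hsplit' : ∀ v : Fin n, m ≤ v.val ↔ v > ⟨m, hm⟩ ∨ v = ⟨m, hm⟩ := fun v => by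
        rw [gt_iff_lt, Fin.lt_def, Fin.ext_iff]
        simp only
        omega
      have e1 : {p | p ∈ K ∧ (∀ v : Fin n, v.val < m + 1 → ¬ HasDesc D S p v) ∧
          ∀ v : Fin n, m + 1 ≤ v.val → ¬ HasDescMax D S p v} =
          Y \ {p | HasDesc D S p ⟨m, hm⟩} := by
        ext p
        simp only [← hY, Set.mem_ofPred_eq, Set.mem_sdiff, hsplit, or_imp, forall_and, forall_eq,
          gt_iff_lt, Fin.lt_def, Nat.succ_le_iff]
        tauto
      have e2 : {p | p ∈ K ∧ (∀ v : Fin n, v.val < m → ¬ HasDesc D S p v) ∧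
          ∀ v : Fin n, m ≤ v.val → ¬ HasDescMax D S p v} =
          Y \ {p | HasDescMax D S p ⟨m, hm⟩} := by
        ext p
        simp only [← hY, Set.mem_ofPred_eq, Set.mem_sdiff, hsplit', or_imp, forall_and, forall_eq,
          gt_iff_lt, Fin.lt_def]
        tauto
      rw [e1, e2]
      omega
  rw [← key n le_rfl]
  congr 1
  ext p
  simp only [Set.mem_ofPred_eq, Fin.is_lt, forall_const]
  refine and_congr_right fun _ => ⟨fun h => ⟨h, fun v hv => absurd v.2 (by omega)⟩, fun h => h.1⟩

end Boards

/-! ### Direct sums of patterns and the board of a pattern. -/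

section Patterns

variable {n k : ℕ} {p p' : Equiv.Perm (Fin n)} {σ : Equiv.Perm (Fin k)}

/-- The entries of `p` at the positions `f 0 < f 1 < ⋯` are order isomorphic to `σ`. -/
def IsOccurrence (p : Equiv.Perm (Fin n)) (σ : Equiv.Perm (Fin k)) (f : Fin k → Fin n) : Prop :=
  StrictMono f ∧ ∀ i j : Fin k, p (f i) < p (f j) ↔ σ i < σ j

theorem IsOccurrence.of_imp {f : Fin k → Fin n} (hf : StrictMono f)
    (h : ∀ i j, σ i < σ j → p (f i) < p (f j)) : IsOccurrence p σ f := by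
  refine ⟨hf, fun i j => ⟨fun hij => ?_, h i j⟩⟩
  rcases lt_trichotomy (σ i) (σ j) with hlt | he | hlt
  · exact hlt
  · rw [σ.injective he] at hij
    exact absurd hij (lt_irrefl _)
  · exact absurd hij (h j i hlt).asymm

/-- The cells strictly to the left and below an occurrence of `σ` in `p`. -/
def patternBoard (p : Equiv.Perm (Fin n)) (σ : Equiv.Perm (Fin k)) (x v : Fin n) : Prop :=
  ∃ f, IsOccurrence p σ f ∧ ∀ i, x < f i ∧ v < p (f i)

theorem isBoard_patternBoard : IsBoard (patternBoard p σ) := by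
  rintro x y u v hxy huv ⟨f, hf, hlt⟩
  exact ⟨f, hf, fun i => ⟨hxy.trans_lt (hlt i).1, huv.trans_lt (hlt i).2⟩⟩

/-- If an entry of the witnessing occurrence lies in the board, an occurrence further right and
above witnesses the same cell. This must stop, since positions increase. -/
theorem patternBoard.exists_outside {x v : Fin n} (h : patternBoard p σ x v) :
    ∃ f, IsOccurrence p σ f ∧ ∀ i, x < f i ∧ v < p (f i) ∧ ¬ patternBoard p σ (f i) (p (f i)) := by
  induction hm : n - x.val using Nat.strong_induction_on generalizing x v with
  | _ m ih =>
    obtain ⟨f, hf, hlt⟩ := h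
    by_cases hi : ∃ i, patternBoard p σ (f i) (p (f i))
    · obtain ⟨i, hi⟩ := hi
      have hxi := (hlt i).1
      obtain ⟨f', hf', hlt'⟩ := ih (n - (f i).val) (by
        have := (f i).2
        rw [Fin.lt_def] at hxi
        omega) hi rfl
      exact ⟨f', hf', fun j => ⟨hxi.trans (hlt' j).1, (hlt i).2.trans (hlt' j).2.1, (hlt' j).2.2⟩⟩
    · push Not at hi
      exact ⟨f, hf, fun i => ⟨(hlt i).1, (hlt i).2, hi i⟩⟩

theorem IsOccurrence.congr {f : Fin k → Fin n} (h : IsOccurrence p σ f)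
    (hp : ∀ i, p (f i) = p' (f i)) : IsOccurrence p' σ f :=
  ⟨h.1, fun i j => by rw [← hp, ← hp, h.2]⟩

/-- Occurrences outside the board are untouched by the change and suffice to determine it. For the
reverse inclusion, being outside the board of `p'` implies being outside that of `p`, by the
inclusion already shown. -/
theorem AgreeOutside.patternBoard_eq (h : AgreeOutside (patternBoard p σ) p p') :
    patternBoard p' σ = patternBoard p σ := by
  have h1 : ∀ x v, patternBoard p σ x v → patternBoard p' σ x v := by
    intro x v hxv
    obtain ⟨f, hf, hlt⟩ := hxv.exists_outside
    have hp : ∀ i, p (f i) = p' (f i) := fun i =>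
      (h (f i)).resolve_right fun hr => (hlt i).2.2 hr.1
    exact ⟨f, hf.congr hp, fun i => ⟨(hlt i).1, hp i ▸ (hlt i).2.1⟩⟩
  ext x v
  refine ⟨fun hxv => ?_, h1 x v⟩
  obtain ⟨f, hf, hlt⟩ := hxv.exists_outside
  have hp : ∀ i, p' (f i) = p (f i) := fun i =>
    ((h (f i)).resolve_right fun hr => (hlt i).2.2 (h1 _ _ hr.2)).symm
  exact ⟨f, hf.congr hp, fun i => ⟨(hlt i).1, hp i ▸ (hlt i).2.1⟩⟩

theorem DescFrom.exists_seq {P : Fin n → Prop} {x : Fin n} {m : ℕ} (h : DescFrom p P m x) :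
    ∃ f : Fin (m + 1) → Fin n, StrictMono f ∧ StrictAnti (p ∘ f) ∧ f 0 = x ∧
      P (f (Fin.last m)) := by
  induction m generalizing x with
  | zero =>
    refine ⟨fun _ => x, fun i j hij => ?_, fun i j hij => ?_, rfl, h⟩ <;>
    · rw [Fin.lt_def] at hij
      omega
  | succ m ih =>
    obtain ⟨-, y, hxy, hy⟩ := h
    obtain ⟨f, hf, hpf, rfl, hP⟩ := ih hy
    refine ⟨Fin.cons x f, ?_, ?_, rfl, by rwa [← Fin.succ_last, Fin.cons_succ]⟩
    · rw [Fin.strictMono_iff_lt_succ]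
      refine Fin.cases hxy.1 fun i => ?_
      rw [Fin.castSucc_succ, Fin.cons_succ, Fin.cons_succ]
      exact hf Fin.castSucc_lt_succ
    · rw [Fin.strictAnti_iff_succ_lt]
      refine Fin.cases hxy.2 fun i => ?_
      simp only [Function.comp, Fin.castSucc_succ, Fin.cons_succ]
      exact hpf Fin.castSucc_lt_succ

theorem DescFrom.of_seq {P : Fin n → Prop} (hP : ∀ x y, x < y → P y → P x) {m : ℕ}
    {f : Fin (m + 1) → Fin n} (hf : StrictMono f) (hpf : StrictAnti (p ∘ f))
    (hlast : P (f (Fin.last m))) : DescFrom p P m (f 0) := by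
  induction m with
  | zero => exact hlast
  | succ m ih =>
    have h1 := ih (f := f ∘ Fin.succ) (hf.comp (Fin.strictMono_succ))
      (hpf.comp_strictMono Fin.strictMono_succ) hlast
    have h2 : Desc p (f 0) (f (Fin.succ 0)) := ⟨hf (Fin.succ_pos 0), hpf (Fin.succ_pos 0)⟩
    exact h1.cons (hP _ _ h2.1 h1.head) h2

variable {S : ℕ} {D : Fin n → Fin n → Prop} {r : Fin n}

theorem hasDesc_iff (hD : IsBoard D) : HasDesc D S p r ↔
    ∃ f : Fin (S + 2) → Fin n, StrictMono f ∧ StrictAnti (p ∘ f) ∧ p (f 0) = r ∧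
      D (f (Fin.last _)) r := by
  constructor
  · rintro ⟨x, rfl, hx⟩
    obtain ⟨f, hf, hpf, rfl, hP⟩ := DescFrom.exists_seq hx
    exact ⟨f, hf, hpf, rfl, hP⟩
  · rintro ⟨f, hf, hpf, rfl, hP⟩
    exact ⟨f 0, rfl, DescFrom.of_seq (P := (D · (p (f 0)))) hD.left hf hpf hP⟩

theorem hasDescMax_iff : HasDescMax D S p r ↔
    ∃ x, p x = r ∧ D x r ∧ ∃ f : Fin (S + 1) → Fin n, StrictMono f ∧ StrictAnti (p ∘ f) ∧
      p (f 0) < r ∧ f (Fin.last _) < x := by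
  refine exists_congr fun x => and_congr_right fun _ => and_congr_right fun _ => ⟨?_, ?_⟩
  · rintro ⟨y, hyx, hy⟩
    obtain ⟨w, hw, hw'⟩ := ChainFrom.join (R := Desc p) (P := (· < x)) (m := 0)
      (fun a b hab hb => hab.1.trans hb) hy hyx
    obtain ⟨f, hf, hpf, rfl, hP⟩ := DescFrom.exists_seq hw'
    exact ⟨f, hf, hpf, hw, hP⟩
  · rintro ⟨f, hf, hpf, h0, hlast⟩
    have h1 := DescFrom.of_seq (P := (· < x)) (fun a b hab hb => hab.trans hb) hf hpf hlast
    obtain ⟨z, hz, hz'⟩ := ChainFrom.join (R := fun y x => Desc p x y) (m := 0)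
      (P := fun a => p a < r) (fun a b hab hb => hab.2.trans hb) h1 h0
    exact ⟨z, hz, hz'⟩

/-- `τ` is the direct sum of `ρ` and `σ`. -/
def IsDirectSum {l : ℕ} (ρ : Equiv.Perm (Fin l)) (σ : Equiv.Perm (Fin k))
    (τ : Equiv.Perm (Fin (l + k))) : Prop :=
  (∀ i, τ (Fin.castAdd k i) = Fin.castAdd k (ρ i)) ∧ ∀ j, τ (Fin.natAdd l j) = Fin.natAdd l (σ j)

/-- An occurrence of `σ` lies to the right of and above a whole occurrence of `ρ` as soon as it does
so for the last position and the largest value. -/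
theorem IsDirectSum.contains_iff {l : ℕ} {ρ : Equiv.Perm (Fin (l + 1))}
    {τ : Equiv.Perm (Fin (l + 1 + k))} (hτ : IsDirectSum ρ σ τ) :
    Contains p τ ↔ ∃ f, IsOccurrence p ρ f ∧
      patternBoard p σ (f (Fin.last l)) (p (f (ρ.symm (Fin.last l)))) := by
  constructor
  · rintro ⟨f, hf, hiso⟩
    refine ⟨f ∘ Fin.castAdd k, ⟨hf.comp (Fin.strictMono_castAdd k), fun i j => ?_⟩,
      f ∘ Fin.natAdd (l + 1), ⟨hf.comp (Fin.strictMono_natAdd _), fun i j => ?_⟩, fun i => ⟨?_, ?_⟩⟩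
    · simp only [Function.comp, hiso, hτ.1, Fin.lt_def, Fin.val_castAdd]
    · simp only [Function.comp, hiso, hτ.2, Fin.lt_def, Fin.val_natAdd]
      omega
    · apply hf
      simp only [Fin.lt_def, Fin.val_castAdd, Fin.val_natAdd, Fin.val_last]
      omega
    · simp only [Function.comp, hiso, hτ.1, hτ.2, Fin.lt_def, Fin.val_castAdd, Fin.val_natAdd,
        Equiv.apply_symm_apply, Fin.val_last]
      omega
  · rintro ⟨f, hf, f', hf', hlt⟩
    have hpos : ∀ i j, f i < f' j := fun i j =>
      (hf.1.monotone (Fin.le_last i)).trans_lt (hlt j).1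
    have hval : ∀ i j, p (f i) < p (f' j) := fun i j => by
      refine lt_of_le_of_lt (not_lt.mp fun h => ?_) (hlt j).2
      rw [hf.2, Equiv.apply_symm_apply] at h
      exact absurd h (not_lt.mpr (Fin.le_last _))
    refine ⟨Fin.append f f', ?_⟩
    apply IsOccurrence.of_imp
    · intro i j
      refine Fin.addCases (fun i => ?_) (fun i => ?_) i <;>
        refine Fin.addCases (fun j => ?_) (fun j => ?_) j <;> intro hij <;>
        simp only [Fin.append_left, Fin.append_right, Fin.lt_def, Fin.val_castAdd,
          Fin.val_natAdd] at hij ⊢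
      · exact hf.1 hij
      · exact hpos i j
      · omega
      · exact hf'.1 (Fin.lt_def.mpr (by omega))
    · intro i j
      refine Fin.addCases (fun i => ?_) (fun i => ?_) i <;>
        refine Fin.addCases (fun j => ?_) (fun j => ?_) j <;> intro hij <;>
        simp only [Fin.append_left, Fin.append_right, hτ.1, hτ.2] at hij ⊢
      · exact (hf.2 i j).mpr hij
      · exact hval i j
      · simp only [Fin.lt_def, Fin.val_castAdd, Fin.val_natAdd] at hij
        omega
      · refine (hf'.2 i j).mpr ?_
        simp only [Fin.lt_def, Fin.val_natAdd] at hij ⊢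
        omega

theorem IsDirectSum.contains_iff_hasDesc {ρ : Equiv.Perm (Fin (S + 2))}
    {τ : Equiv.Perm (Fin (S + 2 + k))} (hτ : IsDirectSum ρ σ τ) (hρ : ∀ i, ρ i = i.rev) :
    Contains p τ ↔ ∃ v, HasDesc (patternBoard p σ) S p v := by
  have h0 : ρ.symm (Fin.last (S + 1)) = 0 := by
    rw [Equiv.symm_apply_eq, hρ, Fin.rev_zero]
  rw [hτ.contains_iff]
  simp only [hasDesc_iff isBoard_patternBoard, h0]
  constructor
  · rintro ⟨f, hf, h⟩
    exact ⟨_, f, hf.1, fun i j hij => (hf.2 j i).mpr (by rwa [hρ, hρ, Fin.rev_lt_rev]), rfl, h⟩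
  · rintro ⟨_, f, hf, hpf, rfl, h⟩
    refine ⟨f, IsOccurrence.of_imp hf fun i j hij => hpf ?_, h⟩
    rwa [hρ, hρ, Fin.rev_lt_rev] at hij

theorem IsDirectSum.contains_iff_hasDescMax {ρ : Equiv.Perm (Fin (S + 2))}
    {τ : Equiv.Perm (Fin (S + 2 + k))} (hτ : IsDirectSum ρ σ τ)
    (hρ : ∀ i : Fin (S + 1), ρ i.castSucc = i.rev.castSucc)
    (hρ' : ρ (Fin.last _) = Fin.last _) :
    Contains p τ ↔ ∃ v, HasDescMax (patternBoard p σ) S p v := by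
  have h0 : ρ.symm (Fin.last (S + 1)) = Fin.last _ := by
    rw [Equiv.symm_apply_eq, hρ']
  rw [hτ.contains_iff]
  simp only [hasDescMax_iff, h0]
  constructor
  · rintro ⟨f, hf, h⟩
    refine ⟨_, f (Fin.last _), rfl, h, f ∘ Fin.castSucc, hf.1.comp Fin.strictMono_castSucc,
      fun i j hij => (hf.2 _ _).mpr ?_, (hf.2 _ _).mpr ?_, hf.1 (Fin.castSucc_lt_last _)⟩
    · rwa [hρ, hρ, Fin.castSucc_lt_castSucc_iff, Fin.rev_lt_rev]
    · rw [hρ, hρ']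
      exact Fin.castSucc_lt_last _
  · rintro ⟨_, x, rfl, h, f, hf, hpf, hval, hlast⟩
    have hx : ∀ i, f i < x := fun i => (hf.monotone (Fin.le_last i)).trans_lt hlast
    have hv : ∀ i, p (f i) < p x := fun i => (hpf.antitone (Fin.zero_le i)).trans_lt hval
    refine ⟨Fin.snoc f x, IsOccurrence.of_imp ?_ ?_, by simpa using h⟩
    · intro i j
      refine Fin.lastCases ?_ (fun i => ?_) i <;> refine Fin.lastCases ?_ (fun j => ?_) j <;>
        intro hij <;> simp only [Fin.snoc_last, Fin.snoc_castSucc]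
      · exact absurd hij (lt_irrefl _)
      · exact absurd hij (Fin.castSucc_lt_last j).asymm
      · exact hx i
      · exact hf (Fin.castSucc_lt_castSucc_iff.mp hij)
    · intro i j
      refine Fin.lastCases ?_ (fun i => ?_) i <;> refine Fin.lastCases ?_ (fun j => ?_) j <;>
        intro hij <;> simp only [Fin.snoc_last, Fin.snoc_castSucc, hρ, hρ'] at hij ⊢
      · exact absurd hij (lt_irrefl _)
      · exact absurd hij (Fin.castSucc_lt_last _).asymm
      · exact hv i
      · exact hpf (Fin.rev_lt_rev.mp (Fin.castSucc_lt_castSucc_iff.mp hij))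

end Patterns

/-- For every `n`, as many permutations of length `n` of each sign avoid `σ` as avoid `τ`. -/
def SignedWilfEquiv {k l : ℕ} (σ : Equiv.Perm (Fin k)) (τ : Equiv.Perm (Fin l)) : Prop :=
  ∀ (n : ℕ) (ε : ℤˣ), {p : Equiv.Perm (Fin n) | Equiv.Perm.sign p = ε ∧ ¬ Contains p σ}.ncard =
    {p : Equiv.Perm (Fin n) | Equiv.Perm.sign p = ε ∧ ¬ Contains p τ}.ncard

theorem SignedWilfEquiv.evenWilfEquiv {k l : ℕ} {σ : Equiv.Perm (Fin k)} {τ : Equiv.Perm (Fin l)}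
    (h : SignedWilfEquiv σ τ) : EvenWilfEquiv σ τ := fun n => h n 1

theorem ncard_eq_of_fibers {α β : Type*} [Finite α] [Finite β] (F : α → β) {A B : Set α}
    (h : ∀ d, {a | a ∈ A ∧ F a = d}.ncard = {a | a ∈ B ∧ F a = d}.ncard) :
    A.ncard = B.ncard := by
  classical
  have := Fintype.ofFinite α
  have := Fintype.ofFinite β
  have key : ∀ C : Set α, C.ncard = ∑ d : β, {a | a ∈ C ∧ F a = d}.ncard := by
    intro C
    rw [Set.ncard_eq_toFinset_card', Finset.card_eq_sum_card_fiberwise (f := F) (t := Finset.univ)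
      (fun _ _ => Finset.mem_coe.mpr (Finset.mem_univ _))]
    refine Finset.sum_congr rfl fun d _ => ?_
    rw [Set.ncard_eq_toFinset_card']
    congr 1
    ext a
    simp
  rw [key A, key B]
  exact Finset.sum_congr rfl fun d _ => h d

/-- The direct sums of `t ⋯ 1` and of `(t - 1) ⋯ 1 t` with a pattern are avoided by equally many
permutations of each sign, for odd `t = S + 2`. -/
theorem signedWilfEquiv_directSum {S k : ℕ} (hS : Odd S) {σ : Equiv.Perm (Fin k)}
    {ρ₁ ρ₂ : Equiv.Perm (Fin (S + 2))} {τ₁ τ₂ : Equiv.Perm (Fin (S + 2 + k))}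
    (hρ₁ : ∀ i, ρ₁ i = i.rev) (hρ₂ : ∀ i : Fin (S + 1), ρ₂ i.castSucc = i.rev.castSucc)
    (hρ₂' : ρ₂ (Fin.last _) = Fin.last _) (h₁ : IsDirectSum ρ₁ σ τ₁) (h₂ : IsDirectSum ρ₂ σ τ₂) :
    SignedWilfEquiv τ₁ τ₂ := by
  intro n ε
  -- The board depends on `p`, so the count is split by its value `D`; relations that are not boards
  -- have empty fibres.
  refine ncard_eq_of_fibers (fun p => patternBoard p σ) fun D => ?_
  by_cases hD : IsBoard D
  · have hK : ClosedInside D {p | Equiv.Perm.sign p = ε ∧ patternBoard p σ = D} := by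
      rintro p p' hp hs ⟨hpε, rfl⟩
      exact ⟨hs ▸ hpε, hp.patternBoard_eq⟩
    convert ncard_board_avoiders_eq hS hD hK using 2 <;> ext p <;>
      simp only [Set.mem_ofPred_eq, h₁.contains_iff_hasDesc hρ₁,
        h₂.contains_iff_hasDescMax hρ₂ hρ₂', not_exists]
    · constructor
      · rintro ⟨⟨h1, h2⟩, rfl⟩
        exact ⟨⟨h1, rfl⟩, h2⟩
      · rintro ⟨⟨h1, rfl⟩, h2⟩
        exact ⟨⟨h1, h2⟩, rfl⟩
    · constructor
      · rintro ⟨⟨h1, h2⟩, rfl⟩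
        exact ⟨⟨h1, rfl⟩, h2⟩
      · rintro ⟨⟨h1, rfl⟩, h2⟩
        exact ⟨⟨h1, h2⟩, rfl⟩
  · have hne : ∀ p : Equiv.Perm (Fin n), patternBoard p σ ≠ D := by
      rintro p rfl
      exact hD isBoard_patternBoard
    simp [hne]

/-! ### Symmetries of containment and their signs. -/

section Symmetries

variable {n k l : ℕ} {p : Equiv.Perm (Fin n)} {σ : Equiv.Perm (Fin k)} {τ : Equiv.Perm (Fin l)}

theorem Contains.reverse (h : Contains p σ) : Contains (p * Fin.revPerm) (σ * Fin.revPerm) := by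
  obtain ⟨f, hf, hiso⟩ := h
  refine ⟨fun i => (f i.rev).rev, fun i j hij => ?_, fun i j => by simpa using hiso _ _⟩
  exact Fin.rev_lt_rev.mpr (hf (Fin.rev_lt_rev.mpr hij))

theorem Contains.complement (h : Contains p σ) : Contains (Fin.revPerm * p) (Fin.revPerm * σ) := by
  obtain ⟨f, hf, hiso⟩ := h
  exact ⟨f, hf, fun i j => by simpa using hiso j i⟩

theorem Contains.inv (h : Contains p σ) : Contains p⁻¹ σ⁻¹ := by
  obtain ⟨f, hf, hiso⟩ := h
  refine ⟨fun i => p (f (σ⁻¹ i)), fun i j hij => (hiso _ _).mpr (by simpa using hij),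
    fun i j => ?_⟩
  simpa using hf.lt_iff_lt

theorem revPerm_mul_self : (Fin.revPerm : Equiv.Perm (Fin n)) * Fin.revPerm = 1 := by
  ext i
  simp

theorem contains_reverse_iff : Contains (p * Fin.revPerm) (σ * Fin.revPerm) ↔ Contains p σ := by
  refine ⟨fun h => ?_, Contains.reverse⟩
  have := h.reverse
  rwa [mul_assoc, mul_assoc, revPerm_mul_self, revPerm_mul_self, mul_one, mul_one] at this

theorem contains_complement_iff : Contains (Fin.revPerm * p) (Fin.revPerm * σ) ↔ Contains p σ := by
  refine ⟨fun h => ?_, Contains.complement⟩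
  have := h.complement
  rwa [← mul_assoc, ← mul_assoc, revPerm_mul_self, revPerm_mul_self, one_mul, one_mul] at this

theorem contains_inv_iff : Contains p⁻¹ σ⁻¹ ↔ Contains p σ :=
  ⟨fun h => by simpa using h.inv, Contains.inv⟩

theorem ncard_avoiders_eq {τ : Equiv.Perm (Fin l)} (e : Equiv.Perm (Fin n) ≃ Equiv.Perm (Fin n))
    (s : ℤˣ) (hs : ∀ p, Equiv.Perm.sign (e p) = Equiv.Perm.sign p * s)
    (he : ∀ p, Contains (e p) τ ↔ Contains p σ) (ε : ℤˣ) :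
    {p : Equiv.Perm (Fin n) | Equiv.Perm.sign p = ε ∧ ¬ Contains p σ}.ncard =
      {p : Equiv.Perm (Fin n) | Equiv.Perm.sign p = ε * s ∧ ¬ Contains p τ}.ncard := by
  rw [← Set.ncard_image_of_injective _ e.injective]
  congr 1
  ext q
  obtain ⟨p, rfl⟩ := e.surjective q
  simp [hs, he]

namespace SignedWilfEquiv

theorem symm (h : SignedWilfEquiv σ τ) : SignedWilfEquiv τ σ := fun n ε => (h n ε).symm

theorem trans {m : ℕ} {υ : Equiv.Perm (Fin m)} (h₁ : SignedWilfEquiv σ τ)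
    (h₂ : SignedWilfEquiv τ υ) : SignedWilfEquiv σ υ := fun n ε => (h₁ n ε).trans (h₂ n ε)

/-- Reversal multiplies all signs by that of the reversing permutation of length `n`, so it may turn
even avoiders into odd ones. This is why the equivalence is carried for both signs. -/
theorem reverse (h : SignedWilfEquiv σ τ) :
    SignedWilfEquiv (σ * Fin.revPerm) (τ * Fin.revPerm) := by
  intro n ε
  have key : ∀ {m : ℕ} (υ : Equiv.Perm (Fin m)) (ε : ℤˣ), _ := fun υ ε =>
    ncard_avoiders_eq (σ := υ) (τ := υ * Fin.revPerm) (Equiv.mulRight (Fin.revPerm (n := n)))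
      (Equiv.Perm.sign (Fin.revPerm (n := n))) (fun p => by simp)
      (fun p => contains_reverse_iff) ε
  have h1 := key σ (ε * Equiv.Perm.sign (Fin.revPerm (n := n)))
  have h2 := key τ (ε * Equiv.Perm.sign (Fin.revPerm (n := n)))
  rw [mul_assoc, Int.units_mul_self, mul_one] at h1 h2
  rw [← h1, ← h2, h]

theorem inv_right (σ : Equiv.Perm (Fin k)) : SignedWilfEquiv σ σ⁻¹ := fun n ε => by
  simpa using ncard_avoiders_eq (Equiv.inv (Equiv.Perm (Fin n))) 1 (fun p => by simp)
    (fun p => contains_inv_iff (σ := σ)) ε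

/-- Reversing both positions and values multiplies the sign by the same factor twice, so even
avoiders stay even and a pattern is equivalent to its own image. -/
theorem revComp_right (σ : Equiv.Perm (Fin k)) :
    SignedWilfEquiv σ (Fin.revPerm * (σ * Fin.revPerm)) := fun n ε => by
  have hs : ∀ p : Equiv.Perm (Fin n), Equiv.Perm.sign (Fin.revPerm * (p * Fin.revPerm)) =
      Equiv.Perm.sign p * 1 := fun p => by
    rw [Equiv.Perm.sign_mul, Equiv.Perm.sign_mul, mul_left_comm, Int.units_mul_self]
  simpa using ncard_avoiders_eq
    ((Equiv.mulRight (Fin.revPerm (n := n))).trans (Equiv.mulLeft Fin.revPerm)) 1 hs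
    (fun p => contains_complement_iff.trans (contains_reverse_iff (σ := σ))) ε

end SignedWilfEquiv

end Symmetries

/-! ### The same relations for one-line notations. -/

section Words

variable {k l m : ℕ} {u u' : Fin k → ℕ} {v v' : Fin l → ℕ} {w : Fin m → ℕ}

/-- `u` and `v` are the one-line notations of permutations that are avoided by equally many
permutations of each length and sign. -/
def SignedWordsEquiv (u : Fin k → ℕ) (v : Fin l → ℕ) : Prop :=
  ∃ (σ : Equiv.Perm (Fin k)) (τ : Equiv.Perm (Fin l)),
    IsOneLine u σ ∧ IsOneLine v τ ∧ SignedWilfEquiv σ τ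

theorem IsOneLine.unique {σ τ : Equiv.Perm (Fin k)} (hσ : IsOneLine u σ) (hτ : IsOneLine u τ) :
    σ = τ := by
  ext i
  have := hσ i
  have := hτ i
  omega

theorem exists_isOneLine (hu : ∀ i, ∃ j : Fin k, u i = j + 1) (hinj : Function.Injective u) :
    ∃ σ : Equiv.Perm (Fin k), IsOneLine u σ := by
  choose f hf using hu
  have hfinj : Function.Injective f := fun i j hij => hinj (by rw [hf, hf, hij])
  exact ⟨Equiv.ofBijective f (Finite.injective_iff_bijective.mp hfinj), hf⟩

namespace SignedWordsEquiv

theorem wordsEquiv (h : SignedWordsEquiv u v) : WordsEquiv u v := by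
  obtain ⟨σ, τ, hσ, hτ, h⟩ := h
  exact ⟨σ, τ, hσ, hτ, h.evenWilfEquiv⟩

theorem symm (h : SignedWordsEquiv u v) : SignedWordsEquiv v u := by
  obtain ⟨σ, τ, hσ, hτ, h⟩ := h
  exact ⟨τ, σ, hτ, hσ, h.symm⟩

theorem trans (h₁ : SignedWordsEquiv u v) (h₂ : SignedWordsEquiv v w) : SignedWordsEquiv u w := by
  obtain ⟨σ, τ, hσ, hτ, h₁⟩ := h₁
  obtain ⟨τ', υ, hτ', hυ, h₂⟩ := h₂
  obtain rfl := hτ.unique hτ'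
  exact ⟨σ, υ, hσ, hυ, h₁.trans h₂⟩

theorem refl_left (h : SignedWordsEquiv u v) : SignedWordsEquiv u u := h.trans h.symm

theorem reverse (h : SignedWordsEquiv (u ∘ Fin.rev) (v ∘ Fin.rev)) : SignedWordsEquiv u v := by
  obtain ⟨σ, τ, hσ, hτ, h⟩ := h
  refine ⟨_, _, fun i => ?_, fun i => ?_, h.reverse⟩
  · simpa using hσ i.rev
  · simpa using hτ i.rev

theorem revComp (h : SignedWordsEquiv u v) (hv : ∀ i, v' i + v i.rev = l + 1) :
    SignedWordsEquiv u v' := by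
  obtain ⟨σ, τ, hσ, hτ, h⟩ := h
  refine ⟨_, _, hσ, fun i => ?_, h.trans (.revComp_right τ)⟩
  have h1 := hv i
  have h2 := hτ i.rev
  have h3 := (τ i.rev).2
  simp only [Equiv.Perm.mul_apply, Fin.revPerm_apply, Fin.val_rev]
  omega

theorem inv (h : SignedWordsEquiv u v) (hv : ∀ i j : Fin l, v j = i + 1 → v' i = j + 1) :
    SignedWordsEquiv u v' := by
  obtain ⟨σ, τ, hσ, hτ, h⟩ := h
  refine ⟨_, _, hσ, fun i => hv _ _ ?_, h.trans (.inv_right τ)⟩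
  simpa using hτ (τ⁻¹ i)

theorem directSum {S : ℕ} (hS : Odd S) (s : Fin k → ℕ) (hs : ∃ σ, IsOneLine s σ)
    {x y : Fin (S + 2 + k) → ℕ}
    (hx : x = Fin.append (fun i : Fin (S + 2) => (i.rev : ℕ) + 1) fun j => s j + (S + 2))
    (hy : y = Fin.append (Fin.snoc (α := fun _ => ℕ) (fun i : Fin (S + 1) => (i.rev : ℕ) + 1)
      (S + 2)) fun j => s j + (S + 2)) :
    SignedWordsEquiv x y := by
  obtain ⟨σ, hσ⟩ := hs
  let sum (ρ : Equiv.Perm (Fin (S + 2))) : Equiv.Perm (Fin (S + 2 + k)) :=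
    finSumFinEquiv.permCongr (Equiv.sumCongr ρ σ)
  have hsum : ∀ ρ, IsDirectSum ρ σ (sum ρ) := fun ρ =>
    ⟨fun i => by simp [sum, Equiv.permCongr_apply], fun j => by simp [sum, Equiv.permCongr_apply]⟩
  have hline : ∀ (ρ : Equiv.Perm (Fin (S + 2))) (a : Fin (S + 2) → ℕ), (∀ i, a i = ρ i + 1) →
      IsOneLine (Fin.append a fun j => s j + (S + 2)) (sum ρ) := by
    intro ρ a ha i
    refine Fin.addCases (fun i => ?_) (fun j => ?_) i
    · rw [Fin.append_left, (hsum ρ).1, ha, Fin.val_castAdd]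
    · rw [Fin.append_right, (hsum ρ).2, hσ, Fin.val_natAdd]
      omega
  -- Rotating before reversing gives `(S + 1) ⋯ 1 (S + 2)`.
  let rot : Equiv.Perm (Fin (S + 2)) := Fin.revPerm * finRotate (S + 2)
  have hrot : ∀ i : Fin (S + 1), rot i.castSucc = i.rev.castSucc := fun i => by
    rw [Fin.ext_iff, Equiv.Perm.mul_apply, Fin.revPerm_apply, Fin.val_rev,
      coe_finRotate_of_ne_last (Fin.castSucc_lt_last i).ne, Fin.val_castSucc, Fin.val_castSucc,
      Fin.val_rev]
    omega
  have hrot' : rot (Fin.last _) = Fin.last _ := by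
    rw [Equiv.Perm.mul_apply, finRotate_last, Fin.revPerm_apply, Fin.rev_zero]
  refine ⟨sum Fin.revPerm, sum rot, hx ▸ hline _ _ fun i => rfl,
    hy ▸ hline _ _ fun i => ?_,
    signedWilfEquiv_directSum hS (fun _ => rfl) hrot hrot' (hsum _) (hsum _)⟩
  refine Fin.lastCases ?_ (fun i => ?_) i
  · rw [Fin.snoc_last, hrot', Fin.val_last]
  · rw [Fin.snoc_castSucc, hrot, Fin.val_castSucc]

end SignedWordsEquiv

/-- Any two words of the list are equivalent. -/
def IsEquivClass (C : List (Fin k → ℕ)) : Prop :=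
  ∀ x ∈ C, ∀ y ∈ C, SignedWordsEquiv x y

theorem IsEquivClass.of_rep {C : List (Fin k → ℕ)} (hC : ∀ v ∈ C, SignedWordsEquiv u v) :
    IsEquivClass C :=
  fun x hx y hy => (hC x hx).symm.trans (hC y hy)

theorem IsEquivClass.reverse {C C' : List (Fin k → ℕ)} (hC : IsEquivClass C)
    (hC' : ∀ x ∈ C', x ∘ Fin.rev ∈ C) : IsEquivClass C' :=
  fun x hx y hy => (hC _ (hC' x hx) _ (hC' y hy)).reverse

end Words

/-! ### The cases `t = 3, 5` and the concrete classes. -/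

theorem signedWordsEquiv_three {k : ℕ} (s : Fin k → ℕ) (hs : ∀ i, ∃ j : Fin k, s i = j + 1)
    (hinj : Function.Injective s) {x y : Fin (1 + 2 + k) → ℕ}
    (hx : x = Fin.append ![3, 2, 1] fun j => s j + 3)
    (hy : y = Fin.append ![2, 1, 3] fun j => s j + 3) : SignedWordsEquiv x y := by
  refine .directSum (S := 1) odd_one s (exists_isOneLine hs hinj) ?_ ?_
  · rw [hx]
    congr 1
    decide
  · rw [hy]
    congr 1
    decide

theorem signedWordsEquiv_five {k : ℕ} (s : Fin k → ℕ) (hs : ∀ i, ∃ j : Fin k, s i = j + 1)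
    (hinj : Function.Injective s) {x y : Fin (3 + 2 + k) → ℕ}
    (hx : x = Fin.append ![5, 4, 3, 2, 1] fun j => s j + 5)
    (hy : y = Fin.append ![4, 3, 2, 1, 5] fun j => s j + 5) : SignedWordsEquiv x y := by
  refine .directSum (S := 3) (by decide) s (exists_isOneLine hs hinj) ?_ ?_
  · rw [hx]
    congr 1
    decide
  · rw [hy]
    congr 1
    decide

theorem isEquivClass_213456 : IsEquivClass [
      ![1, 2, 3, 4, 6, 5], ![1, 2, 3, 6, 5, 4], ![2, 1, 3, 4, 5, 6], ![3, 2, 1, 4, 5, 6]] := by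
  have h : SignedWordsEquiv (![3, 2, 1, 4, 5, 6] : Fin 6 → ℕ) (![2, 1, 3, 4, 5, 6] : Fin 6 → ℕ) :=
    signedWordsEquiv_three (k := 3) ![1, 2, 3] (by decide) (by decide) (by decide) (by decide)
  refine IsEquivClass.of_rep (u := ![3, 2, 1, 4, 5, 6]) ?_
  simp only [List.forall_mem_cons]
  exact ⟨h.revComp (by decide), h.refl_left.revComp (by decide), h, h.refl_left,
    List.forall_mem_nil _⟩

theorem isEquivClass_432156 : IsEquivClass [
      ![1, 2, 6, 5, 4, 3], ![1, 6, 5, 4, 3, 2], ![4, 3, 2, 1, 5, 6], ![5, 4, 3, 2, 1, 6]] := by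
  have h : SignedWordsEquiv (![5, 4, 3, 2, 1, 6] : Fin 6 → ℕ) (![4, 3, 2, 1, 5, 6] : Fin 6 → ℕ) :=
    signedWordsEquiv_five (k := 1) ![1] (by decide) (by decide) (by decide) (by decide)
  refine IsEquivClass.of_rep (u := ![5, 4, 3, 2, 1, 6]) ?_
  simp only [List.forall_mem_cons]
  exact ⟨h.revComp (by decide), h.refl_left.revComp (by decide), h, h.refl_left,
    List.forall_mem_nil _⟩

theorem isEquivClass_213546 : IsEquivClass [
      ![1, 3, 2, 4, 6, 5], ![1, 3, 2, 6, 5, 4], ![2, 1, 3, 5, 4, 6], ![3, 2, 1, 5, 4, 6]] := by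
  have h : SignedWordsEquiv (![3, 2, 1, 5, 4, 6] : Fin 6 → ℕ) (![2, 1, 3, 5, 4, 6] : Fin 6 → ℕ) :=
    signedWordsEquiv_three (k := 3) ![2, 1, 3] (by decide) (by decide) (by decide) (by decide)
  refine IsEquivClass.of_rep (u := ![3, 2, 1, 5, 4, 6]) ?_
  simp only [List.forall_mem_cons]
  exact ⟨h.revComp (by decide), h.refl_left.revComp (by decide), h, h.refl_left,
    List.forall_mem_nil _⟩

theorem isEquivClass_213465 : IsEquivClass [
      ![2, 1, 3, 4, 6, 5], ![2, 1, 3, 6, 5, 4], ![3, 2, 1, 4, 6, 5], ![3, 2, 1, 6, 5, 4]] := by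
  have h : SignedWordsEquiv (![3, 2, 1, 6, 5, 4] : Fin 6 → ℕ) (![2, 1, 3, 6, 5, 4] : Fin 6 → ℕ) :=
    signedWordsEquiv_three (k := 3) ![3, 2, 1] (by decide) (by decide) (by decide) (by decide)
  have h₁ : SignedWordsEquiv (![3, 2, 1, 6, 5, 4] : Fin 6 → ℕ) ![3, 2, 1, 4, 6, 5] :=
    h.revComp (by decide)
  have h₂ : SignedWordsEquiv (![3, 2, 1, 4, 6, 5] : Fin 6 → ℕ) (![2, 1, 3, 4, 6, 5] : Fin 6 → ℕ) :=
    signedWordsEquiv_three (k := 3) ![1, 3, 2] (by decide) (by decide) (by decide) (by decide)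
  refine IsEquivClass.of_rep (u := ![3, 2, 1, 6, 5, 4]) ?_
  simp only [List.forall_mem_cons]
  exact ⟨h₁.trans h₂, h, h₁, h.refl_left, List.forall_mem_nil _⟩

theorem isEquivClass_213564 : IsEquivClass [
      ![2, 1, 3, 5, 6, 4], ![2, 1, 3, 6, 4, 5], ![2, 3, 1, 4, 6, 5], ![2, 3, 1, 6, 5, 4],
      ![3, 1, 2, 4, 6, 5], ![3, 1, 2, 6, 5, 4], ![3, 2, 1, 5, 6, 4], ![3, 2, 1, 6, 4, 5]] := by
  have h : SignedWordsEquiv (![3, 2, 1, 5, 6, 4] : Fin 6 → ℕ) (![2, 1, 3, 5, 6, 4] : Fin 6 → ℕ) :=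
    signedWordsEquiv_three (k := 3) ![2, 3, 1] (by decide) (by decide) (by decide) (by decide)
  -- Inversion fixes the blocks `321` and `213` and swaps the summands `231` and `312`, which links
  -- the two families.
  have h₁ : SignedWordsEquiv (![3, 2, 1, 5, 6, 4] : Fin 6 → ℕ) ![2, 1, 3, 6, 4, 5] :=
    h.inv (by decide)
  have h₂ : SignedWordsEquiv (![3, 2, 1, 5, 6, 4] : Fin 6 → ℕ) ![3, 2, 1, 6, 4, 5] :=
    h₁.trans (SignedWordsEquiv.symm <|
      signedWordsEquiv_three (k := 3) ![3, 1, 2] (by decide) (by decide) (by decide) (by decide))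
  refine IsEquivClass.of_rep (u := ![3, 2, 1, 5, 6, 4]) ?_
  simp only [List.forall_mem_cons]
  exact ⟨h, h₁, h₁.revComp (by decide), h₂.revComp (by decide), h.revComp (by decide),
    h.refl_left.revComp (by decide), h.refl_left, h₂,
    List.forall_mem_nil _⟩

theorem signedWordsEquiv_12354 :
    SignedWordsEquiv (![1, 2, 3, 5, 4] : Fin 5 → ℕ) ![1, 2, 5, 4, 3] := by
  have h : SignedWordsEquiv (![3, 2, 1, 4, 5] : Fin 5 → ℕ) (![2, 1, 3, 4, 5] : Fin 5 → ℕ) :=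
    signedWordsEquiv_three (k := 2) ![1, 2] (by decide) (by decide) (by decide) (by decide)
  have h₁ : SignedWordsEquiv (![3, 2, 1, 4, 5] : Fin 5 → ℕ) ![1, 2, 3, 5, 4] :=
    h.revComp (by decide)
  have h₂ : SignedWordsEquiv (![3, 2, 1, 4, 5] : Fin 5 → ℕ) ![1, 2, 5, 4, 3] :=
    h.refl_left.revComp (by decide)
  exact h₁.symm.trans h₂

theorem signedWordsEquiv_21354 :
    SignedWordsEquiv (![2, 1, 3, 5, 4] : Fin 5 → ℕ) ![2, 1, 5, 4, 3] := by
  have h : SignedWordsEquiv (![3, 2, 1, 5, 4] : Fin 5 → ℕ) (![2, 1, 3, 5, 4] : Fin 5 → ℕ) :=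
    signedWordsEquiv_three (k := 2) ![2, 1] (by decide) (by decide) (by decide) (by decide)
  have h₁ : SignedWordsEquiv (![3, 2, 1, 5, 4] : Fin 5 → ℕ) ![2, 1, 5, 4, 3] :=
    h.refl_left.revComp (by decide)
  exact h.symm.trans h₁

theorem signedWordsEquiv_15432 :
    SignedWordsEquiv (![1, 5, 4, 3, 2] : Fin 5 → ℕ) ![5, 4, 3, 2, 1] := by
  have h : SignedWordsEquiv (![5, 4, 3, 2, 1] : Fin 5 → ℕ) (![4, 3, 2, 1, 5] : Fin 5 → ℕ) :=
    -- The second summand is empty here.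
    signedWordsEquiv_five (k := 0) (![] : Fin 0 → ℕ) (by decide) (by decide) (by decide) (by decide)
  have h₁ : SignedWordsEquiv (![5, 4, 3, 2, 1] : Fin 5 → ℕ) ![1, 5, 4, 3, 2] :=
    h.revComp (by decide)
  exact h₁.symm

theorem SignedWordsEquiv.of_reverse_eq {k : ℕ} {u v u' v' : Fin k → ℕ} (h : SignedWordsEquiv u v)
    (hu : u' ∘ Fin.rev = u) (hv : v' ∘ Fin.rev = v) : SignedWordsEquiv u' v' := by
  subst hu hv
  exact h.reverse

end EvenWilf

theorem mainTheorem4 :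
    (EvenWilf.WordsEquiv ![1, 2, 3, 4, 5] ![2, 3, 4, 5, 1] ∧
      EvenWilf.WordsEquiv ![4, 5, 3, 1, 2] ![3, 4, 5, 1, 2] ∧
      EvenWilf.WordsEquiv ![1, 5, 4, 3, 2] ![5, 4, 3, 2, 1] ∧
      EvenWilf.WordsEquiv ![2, 1, 3, 5, 4] ![2, 1, 5, 4, 3] ∧
      EvenWilf.WordsEquiv ![1, 2, 3, 5, 4] ![1, 2, 5, 4, 3] ∧
      EvenWilf.WordsEquiv ![4, 5, 3, 2, 1] ![3, 4, 5, 2, 1]) ∧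
    (∀ C ∈ ([
        [![1, 2, 3, 4, 6, 5], ![1, 2, 3, 6, 5, 4], ![2, 1, 3, 4, 5, 6], ![3, 2, 1, 4, 5, 6]],
        [![1, 2, 6, 5, 4, 3], ![1, 6, 5, 4, 3, 2], ![4, 3, 2, 1, 5, 6], ![5, 4, 3, 2, 1, 6]],
        [![1, 3, 2, 4, 6, 5], ![1, 3, 2, 6, 5, 4], ![2, 1, 3, 5, 4, 6], ![3, 2, 1, 5, 4, 6]],
        [![2, 1, 3, 4, 6, 5], ![2, 1, 3, 6, 5, 4], ![3, 2, 1, 4, 6, 5], ![3, 2, 1, 6, 5, 4]],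
        [![2, 1, 3, 5, 6, 4], ![2, 1, 3, 6, 4, 5], ![2, 3, 1, 4, 6, 5], ![2, 3, 1, 6, 5, 4],
         ![3, 1, 2, 4, 6, 5], ![3, 1, 2, 6, 5, 4], ![3, 2, 1, 5, 6, 4], ![3, 2, 1, 6, 4, 5]],
        [![2, 3, 4, 5, 6, 1], ![3, 4, 5, 6, 2, 1], ![6, 1, 2, 3, 4, 5], ![6, 5, 1, 2, 3, 4]],
        [![4, 5, 6, 1, 2, 3], ![4, 5, 6, 3, 1, 2], ![5, 6, 4, 1, 2, 3], ![5, 6, 4, 3, 1, 2]],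
        [![4, 5, 6, 1, 3, 2], ![4, 5, 6, 2, 1, 3], ![4, 6, 5, 1, 2, 3], ![4, 6, 5, 3, 1, 2],
         ![5, 4, 6, 1, 2, 3], ![5, 4, 6, 3, 1, 2], ![5, 6, 4, 1, 3, 2], ![5, 6, 4, 2, 1, 3]],
        [![4, 5, 6, 2, 3, 1], ![5, 6, 4, 2, 3, 1], ![6, 4, 5, 1, 2, 3], ![6, 4, 5, 3, 1, 2]],
        [![4, 5, 6, 3, 2, 1], ![5, 6, 4, 3, 2, 1], ![6, 5, 4, 1, 2, 3], ![6, 5, 4, 3, 1, 2]]] : List (List (Fin 6 → ℕ))),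
      ∀ u ∈ C, ∀ v ∈ C, EvenWilf.WordsEquiv u v) := by
  refine ⟨⟨?_, ?_, ?_, ?_, ?_, ?_⟩, ?_⟩
  · exact (EvenWilf.signedWordsEquiv_15432.symm.of_reverse_eq (by decide) (by decide)).wordsEquiv
  · exact (EvenWilf.signedWordsEquiv_21354.of_reverse_eq (by decide) (by decide)).wordsEquiv
  · exact EvenWilf.signedWordsEquiv_15432.wordsEquiv
  · exact EvenWilf.signedWordsEquiv_21354.wordsEquiv
  · exact EvenWilf.signedWordsEquiv_12354.wordsEquiv
  · exact (EvenWilf.signedWordsEquiv_12354.of_reverse_eq (by decide) (by decide)).wordsEquiv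
  · suffices h : ∀ C ∈ _, EvenWilf.IsEquivClass C from
      fun C hC u hu v hv => (h C hC u hu v hv).wordsEquiv
    simp only [List.forall_mem_cons (p := EvenWilf.IsEquivClass)]
    -- The last five classes are the reversals of the first five, in another order.
    refine ⟨EvenWilf.isEquivClass_213456, EvenWilf.isEquivClass_432156,
      EvenWilf.isEquivClass_213546, EvenWilf.isEquivClass_213465,
      EvenWilf.isEquivClass_213564,
      EvenWilf.isEquivClass_432156.reverse (by decide),
      EvenWilf.isEquivClass_213465.reverse (by decide),
      EvenWilf.isEquivClass_213564.reverse (by decide),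
      EvenWilf.isEquivClass_213546.reverse (by decide),
      EvenWilf.isEquivClass_213456.reverse (by decide),
      List.forall_mem_nil _⟩
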